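/- Let $\Theta\subset\mathbb{R}^d$ be compact with $\mathrm{Leb}(\Theta)>0$, and let $f_\theta(y)=(2\pi)^{-d/2}e^{-\frac12\|y-\theta\|^2}$, $\theta\in\Theta$, be the density of $P_\theta=\mathcal N(\theta,I_d)$. For $y^n=(y_1,\dots,y_n)\in(\mathbb{R}^d)^n$ and a probability density $q$ on $(\mathbb{R}^d)^n$ put $R_q(y^n,\theta)=\log\frac{\prod_{t=1}^n f_\theta(y_t)}{q(y^n)}\in(-\infty,+\infty]$, and let $$C_n=\inf_{Q}\sup_{\theta\in\Theta}D(P_\theta^{\otimes n}\|Q),\qquad F_n^{(PAC)}=\inf_q\sup_{P}\sup_{\theta\in\Theta}\mathbb{E}_{Y^n\sim P^{\otimes n}}[R_q(Y^n,\theta)],\qquad \Gamma_n=\inf_q\sup_{y^n}\sup_{\theta\in\Theta}R_q(y^n,\theta),$$ where $Q$ ranges over all probability measures on $(\mathbb{R}^d)^n$, $P$ over all probability measures on $\mathbb{R}^d$, and $q$ over all probability densities on $(\mathbb{R}^d)^n$ (in $F_n^{(PAC)}$: over those for which all these expectations are well defined in $[-\infty,+\infty]$). Then, as $n\to\infty$,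 all three quantities being finite for every $n\ge1$, $$F_n^{(PAC)}=C_n+o(1),\qquad \Gamma_n=C_n+\tfrac d2+o(1).$$ Moreover, a single explicit estimator attains both optimal values up to $o(1)$. Let $\Theta_\tau=\{x:\mathrm{dist}(x,\Theta)\le\tau\}$, $\bar y=\frac1n\sum_t y_t$, $$m_{v,\tau}(y^n)=\sup_{\theta\in\Theta_\tau}(2\pi v)^{-nd/2}e^{-\frac1{2v}\sum_t\|y_t-\theta\|^2},\qquad p_E(y^n)=(2\pi)^{-(n-1)d/2}e^{-\frac12\sum_t\|y_t-\bar y\|^2}\Big(\frac{\alpha}{2\sqrt n}\Big)^d e^{-\alpha\|\bar y\|_1}.$$ For every $\alpha>0$ there are sequences $\tau_n>0$, $\lambda_n\in(0,1)$, $\beta_n>0$ with $\tau_n\to0$, $\lambda_n\to0$, $\beta_n/n\to0$ such that, with $v_n=1-\frac1n+\frac{\beta_n}{n^2}$: (a) the density $q_n=(1-\lambda_n)\,p_S+\lambda_n\,p_E$, where $p_S$ is $m_{v_n,\tau_n}$ normalized to integrate to one, is admissible in $F_n^{(PAC)}$ and satisfies $\sup_P\sup_{\theta\in\Theta}\mathbb{E}_{P^{\otimes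 n}}[R_{q_n}(Y^n,\theta)]\le C_n+o(1)$; (b) the density $q_n'=(1-\lambda_n)\,p_S'+\lambda_n\,p_E$, where $p_S'$ is $\max(m_{v_n,\tau_n},m_{1,\tau_n})$ normalized to integrate to one, is admissible and satisfies simultaneously $\sup_P\sup_{\theta\in\Theta}\mathbb{E}_{P^{\otimes n}}[R_{q_n'}(Y^n,\theta)]\le C_n+o(1)$ and $\sup_{y^n}\sup_{\theta\in\Theta}R_{q_n'}(y^n,\theta)\le\Gamma_n+o(1)$. -/

import Mathlib

open MeasureTheory Filter Topology
open scoped ENNReal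

namespace Misspecified

/-! ### Extended logarithmic ratios and expectations -/

/-- `log (a / b)` for `a, b ≥ 0`, with values in `[-∞, ∞]` and the conventions
`log (0 / c) = -∞`, `log (c / 0) = +∞` (for `c > 0`) and `log (0 / 0) = 0`. -/
noncomputable def logRatio (a b : ℝ) : EReal :=
  if b = 0 then (if a = 0 then 0 else ⊤)
  else if a = 0 then ⊥ else ((Real.log (a / b) : ℝ) : EReal)

section Expectation

variable {Ω : Type*} [MeasurableSpace Ω]

/-- `E[max(X, 0)]`. -/
noncomputable def posExp (P : Measure Ω) (X : Ω → EReal) : ℝ≥0∞ :=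
  ∫⁻ ω, (X ω).toENNReal ∂P

/-- `E[max(-X, 0)]`. -/
noncomputable def negExp (P : Measure Ω) (X : Ω → EReal) : ℝ≥0∞ :=
  ∫⁻ ω, (-(X ω)).toENNReal ∂P

/-- The expectation `E[X]` is defined (possibly infinite) unless both parts are infinite. -/
def ExpDefined (P : Measure Ω) (X : Ω → EReal) : Prop :=
  posExp P X ≠ ⊤ ∨ negExp P X ≠ ⊤

/-- The expectation of an extended-real random variable, meaningful under `ExpDefined`. -/
noncomputable def expect (P : Measure Ω) (X : Ω → EReal) : EReal :=
  (posExp P X : EReal) - (negExp P X : EReal)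

end Expectation

/-! ### Regret -/

section Regret

variable {𝒴 ι : Type*} [MeasurableSpace 𝒴]

/-- `q` is a probability density on `𝒴ⁿ` with respect to `μ^{⊗n}`. -/
def IsDensity (μ : Measure 𝒴) (n : ℕ) (q : (Fin n → 𝒴) → ℝ) : Prop :=
  Measurable q ∧ (∀ y, 0 ≤ q y) ∧
    ∫⁻ y, ENNReal.ofReal (q y) ∂(Measure.pi fun _ : Fin n => μ) = 1

/-- The log-likelihood ratio `log (∏ₜ f_θ(yₜ) / q(yⁿ))`. -/
noncomputable def regretAt (f : ι → 𝒴 → ℝ) {n : ℕ} (q : (Fin n → 𝒴) → ℝ) (θ : ι)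
    (y : Fin n → 𝒴) : EReal :=
  logRatio (∏ t, f θ (y t)) (q y)

/-- The expected log-likelihood ratio is well defined for all `P ∈ Φ` and `θ ∈ Θ`. -/
def Admissible (f : ι → 𝒴 → ℝ) (Θ : Set ι) {n : ℕ} (Φ : Set (Measure (Fin n → 𝒴)))
    (q : (Fin n → 𝒴) → ℝ) : Prop :=
  ∀ P ∈ Φ, ∀ θ ∈ Θ, ExpDefined P (regretAt f q θ)

/-- The worst-case expected regret of `q` over `P ∈ Φ` and `θ ∈ Θ`. -/
noncomputable def worstRegret (f : ι → 𝒴 → ℝ) (Θ : Set ι) {n : ℕ}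
    (Φ : Set (Measure (Fin n → 𝒴))) (q : (Fin n → 𝒴) → ℝ) : EReal :=
  ⨆ P ∈ Φ, ⨆ θ ∈ Θ, expect P (regretAt f q θ)

/-- The misspecified minimax regret `F_n({f_θ}, μ, Φ)`; it is `⊤` if no `q` is admissible. -/
noncomputable def minimaxRegret (f : ι → 𝒴 → ℝ) (Θ : Set ι) (μ : Measure 𝒴) {n : ℕ}
    (Φ : Set (Measure (Fin n → 𝒴))) : EReal :=
  ⨅ (q : (Fin n → 𝒴) → ℝ) (_ : IsDensity μ n q ∧ Admissible f Θ Φ q), worstRegret f Θ Φ q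

variable (𝒴) in
/-- All iid distributions on `𝒴ⁿ`. -/
def iidLaws (n : ℕ) : Set (Measure (Fin n → 𝒴)) :=
  {M | ∃ P : Measure 𝒴, IsProbabilityMeasure P ∧ M = Measure.pi fun _ : Fin n => P}

/-- The distribution-free regret `F_n^{(PAC)}`. -/
noncomputable def pacRegret (f : ι → 𝒴 → ℝ) (Θ : Set ι) (μ : Measure 𝒴) (n : ℕ) : EReal :=
  minimaxRegret f Θ μ (iidLaws 𝒴 n)

/-- The worst-case regret of `q` over all individual sequences and all `θ ∈ Θ`. -/
noncomputable def worstSeqRegret (f : ι → 𝒴 → ℝ) (Θ : Set ι) {n : ℕ}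
    (q : (Fin n → 𝒴) → ℝ) : EReal :=
  ⨆ y : Fin n → 𝒴, ⨆ θ ∈ Θ, regretAt f q θ y

/-- The individual-sequence regret `Γ_n`. -/
noncomputable def seqRegret (f : ι → 𝒴 → ℝ) (Θ : Set ι) (μ : Measure 𝒴) (n : ℕ) : EReal :=
  ⨅ (q : (Fin n → 𝒴) → ℝ) (_ : IsDensity μ n q), worstSeqRegret f Θ q

/-- The capacity `C_n(Θ) = inf_Q sup_{θ ∈ Θ} D(P_θ^{⊗n} ‖ Q)`, over all probability measures
`Q` on `𝒴ⁿ`, where `P_θ` has density `f_θ` with respect to `μ`. -/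
noncomputable def capacity (f : ι → 𝒴 → ℝ) (Θ : Set ι) (μ : Measure 𝒴) (n : ℕ) : ℝ≥0∞ :=
  ⨅ (Q : Measure (Fin n → 𝒴)) (_ : IsProbabilityMeasure Q), ⨆ θ ∈ Θ,
    InformationTheory.klDiv
      (Measure.pi fun _ : Fin n => μ.withDensity fun y => ENNReal.ofReal (f θ y)) Q

end Regret

/-! ### The Gaussian location model and the estimators -/

section Gaussian

variable {d : ℕ}

/-- The density of `N(θ, I_d)`. -/
noncomputable def gaussDensity (θ y : EuclideanSpace ℝ (Fin d)) : ℝ :=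
  (2 * Real.pi) ^ (-(d : ℝ) / 2) * Real.exp (-(1 / 2) * ‖y - θ‖ ^ 2)

/-- `sup_{θ ∈ Θ_τ} (2πv)^{-nd/2} exp(-(1/2v) ∑ₜ ‖yₜ - θ‖²)`, where
`Θ_τ = {x : dist(x, Θ) ≤ τ}`. -/
noncomputable def maxLikelihood (Θ : Set (EuclideanSpace ℝ (Fin d))) (v τ : ℝ) {n : ℕ}
    (y : Fin n → EuclideanSpace ℝ (Fin d)) : ℝ :=
  ⨆ θ : Metric.cthickening τ Θ,
    (2 * Real.pi * v) ^ (-((n : ℝ) * d) / 2) *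
      Real.exp (-(1 / (2 * v)) * ∑ t, ‖y t - (θ : EuclideanSpace ℝ (Fin d))‖ ^ 2)

/-- Division of a function by its Lebesgue integral. -/
noncomputable def normalized {n : ℕ} (g : (Fin n → EuclideanSpace ℝ (Fin d)) → ℝ)
    (y : Fin n → EuclideanSpace ℝ (Fin d)) : ℝ :=
  g y / ∫ z, g z

/-- The Shtarkov density of the enlarged set `Θ_τ` with variance `v`. -/
noncomputable def shtarkov (Θ : Set (EuclideanSpace ℝ (Fin d))) (v τ : ℝ) (n : ℕ) :
    (Fin n → EuclideanSpace ℝ (Fin d)) → ℝ :=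
  normalized fun y => maxLikelihood Θ v τ y

/-- The Shtarkov density of the enlarged set `Θ_τ` with the two variances `v` and `1`. -/
noncomputable def shtarkovTwo (Θ : Set (EuclideanSpace ℝ (Fin d))) (v τ : ℝ) (n : ℕ) :
    (Fin n → EuclideanSpace ℝ (Fin d)) → ℝ :=
  normalized fun y => max (maxLikelihood Θ v τ y) (maxLikelihood Θ 1 τ y)

/-- The sample mean. -/
noncomputable def sampleMean {n : ℕ} (y : Fin n → EuclideanSpace ℝ (Fin d)) :
    EuclideanSpace ℝ (Fin d) :=
  (n : ℝ)⁻¹ • ∑ t, y t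

/-- The robustification density: Gaussian in `y_⊥ = (yₜ - ȳ)ₜ`, Laplace in the mean `ȳ`. -/
noncomputable def laplaceTail (α : ℝ) (n : ℕ) (y : Fin n → EuclideanSpace ℝ (Fin d)) : ℝ :=
  (2 * Real.pi) ^ (-(((n : ℝ) - 1) * d) / 2) *
    Real.exp (-(1 / 2) * ∑ t, ‖y t - sampleMean y‖ ^ 2) *
    ((α / (2 * Real.sqrt n)) ^ d * Real.exp (-α * ∑ j, |sampleMean y j|))

/-- The mixture `(1 - lam) p + lam p'`. -/
noncomputable def mixture {Ω : Type*} (lam : ℝ) (p p' : Ω → ℝ) (y : Ω) : ℝ :=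
  (1 - lam) * p y + lam * p' y

/-- The tweaked variance `1 - 1/n + β/n²`. -/
noncomputable def tweakedVar (β : ℝ) (n : ℕ) : ℝ := 1 - 1 / (n : ℝ) + β / (n : ℝ) ^ 2

end Gaussian

end Misspecified

/-! Write `r = ‖ȳ - θ‖`, let `S` be the scatter `∑ₜ ‖yₜ - ȳ‖²`, and put `Lₙ = (d/2) log(n/2π) - d/2
+ log Vol(Θ)`. Everything follows from `Lₙ ≤ Cₙ ≤ Fₙ ≤ Lₙ + o(1)` and `Lₙ + d/2 ≤ Γₙ ≤ Lₙ + d/2 +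
o(1)`. In particular, the upper bound on the capacity comes from the robust estimator.

Lower bounds. For a given `Q`, a Donsker–Varadhan test function `const - n r²/2`, averaged over `θ`
uniform on `Θ`, yields some `θ` with `D(P_θⁿ‖Q) ≥ Lₙ` (`ofReal_le_capacity`). The model laws are
themselves iid, so `Cₙ ≤ Fₙ` (`capacity_le_worstRegret`). For `Γₙ`, the Shtarkov integral is
restricted to `ȳ ∈ Θ` (`coe_le_seqRegret`).

Upper bounds. If `ȳ` lies in the tube `Θ_τ`, the Shtarkov density with variance `v` has regret at
most `(nd/2) log v + log Z + (1/v - 1) S/2 - n r²/2 - log(1 - λ)`. For iid data `E S ≤ n(n-1) E r²`,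
whatever the law (`integral_sq_norm_le_mul_integral_sampleMean`). With `v = 1 - 1/n` the two
quadratic terms exactly balance, and `(nd/2) log v ≈ -d/2` is the gap between `Fₙ` and `Γₙ`. If `ȳ`
is off the tube, the Laplace component keeps the regret under control at a cost `-log λ + O(1)`.
There `r ≥ τ`, so this cost is at most `(β/2) r²` (`regretAt_le_scatter`). The correction `β/n²` in
`v` restores the balance (`worstRegret_mixture_le`). If `E r² = ∞`, the expected regret is `-∞`.

The normalizers satisfy `log Z ≤ (d/2) log(n/2π) + log Vol(Θ) + o(1)`. Taking the maximum with the
variance-one likelihood does not change this: the two Gaussian weights in `S` differ by a vanishing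
chi-square distance (`integral_max_maxLikelihood_le`). That maximum also dominates the true
likelihood, which gives the bound for individual sequences. -/

namespace Misspecified

section

/-! ### Calculus of extended-real expectations. -/

section Expectation

variable {Ω : Type*} [MeasurableSpace Ω] {P : Measure Ω}

theorem posExp_mono {X Y : Ω → EReal} (h : ∀ ω, X ω ≤ Y ω) : posExp P X ≤ posExp P Y :=
  lintegral_mono fun ω => EReal.toENNReal_le_toENNReal (h ω)

theorem negExp_anti {X Y : Ω → EReal} (h : ∀ ω, X ω ≤ Y ω) : negExp P Y ≤ negExp P X :=
  lintegral_mono fun ω => EReal.toENNReal_le_toENNReal (EReal.neg_le_neg_iff.2 (h ω))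

theorem expect_mono {X Y : Ω → EReal} (h : ∀ ω, X ω ≤ Y ω) : expect P X ≤ expect P Y :=
  EReal.sub_le_sub (by exact_mod_cast posExp_mono h) (by exact_mod_cast negExp_anti h)

theorem posExp_coe (Y : Ω → ℝ) :
    posExp P (fun ω => (Y ω : EReal)) = ∫⁻ ω, ENNReal.ofReal (Y ω) ∂P := by
  simp [posExp]

theorem negExp_coe (Y : Ω → ℝ) :
    negExp P (fun ω => (Y ω : EReal)) = ∫⁻ ω, ENNReal.ofReal (-Y ω) ∂P := by
  simp only [negExp, ← EReal.coe_neg]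
  rfl

theorem expect_coe {Y : Ω → ℝ} (hY : Integrable Y P) :
    expect P (fun ω => (Y ω : EReal)) = ((∫ ω, Y ω ∂P : ℝ) : EReal) := by
  have h1 : ∫⁻ ω, ENNReal.ofReal (Y ω) ∂P ≠ ⊤ := hY.lintegral_lt_top.ne
  have h2 : ∫⁻ ω, ENNReal.ofReal (-Y ω) ∂P ≠ ⊤ := hY.neg.lintegral_lt_top.ne
  rw [expect, posExp_coe, negExp_coe, integral_eq_lintegral_pos_part_sub_lintegral_neg_part hY,
    EReal.coe_sub, EReal.coe_ennreal_toReal h1, EReal.coe_ennreal_toReal h2]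

theorem expect_le_integral {X : Ω → EReal} {Y : Ω → ℝ} (hY : Integrable Y P)
    (h : ∀ ω, X ω ≤ Y ω) : expect P X ≤ ((∫ ω, Y ω ∂P : ℝ) : EReal) :=
  (expect_mono h).trans_eq (expect_coe hY)

theorem posExp_ne_top [IsProbabilityMeasure P] {X : Ω → EReal} {K : ℝ} (h : ∀ ω, X ω ≤ K) :
    posExp P X ≠ ⊤ := by
  refine ne_top_of_le_ne_top ?_ (posExp_mono (P := P) h)
  simp [posExp_coe]

theorem expect_le_const [IsProbabilityMeasure P] {X : Ω → EReal} {K : ℝ} (h : ∀ ω, X ω ≤ K) :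
    expect P X ≤ K := by
  simpa using expect_le_integral (P := P) (integrable_const K) h

theorem expect_eq_bot {X : Ω → EReal} (h1 : posExp P X ≠ ⊤) (h2 : negExp P X = ⊤) :
    expect P X = ⊥ := by
  rw [expect, h2]
  lift posExp P X to NNReal using h1 with p
  simp

theorem integrable_of_posExp_of_negExp {Y : Ω → ℝ} (hY : AEStronglyMeasurable Y P)
    (h1 : posExp P (fun ω => (Y ω : EReal)) ≠ ⊤) (h2 : negExp P (fun ω => (Y ω : EReal)) ≠ ⊤) :
    Integrable Y P := by
  rw [posExp_coe] at h1
  rw [negExp_coe] at h2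
  refine ⟨hY, ?_⟩
  have : ∀ ω, ‖Y ω‖ₑ = ENNReal.ofReal (Y ω) + ENNReal.ofReal (-Y ω) := by
    intro ω
    rw [Real.enorm_eq_ofReal_abs]
    rcases le_total 0 (Y ω) with h | h
    · rw [abs_of_nonneg h, ENNReal.ofReal_of_nonpos (neg_nonpos.2 h), add_zero]
    · rw [abs_of_nonpos h, ENNReal.ofReal_of_nonpos h, zero_add]
  rw [HasFiniteIntegral]
  simp_rw [this]
  rw [lintegral_add_left' hY.aemeasurable.ennreal_ofReal]
  exact ENNReal.add_lt_top.2 ⟨h1.lt_top, h2.lt_top⟩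

theorem posExp_negExp_congr_ae {X Y : Ω → EReal} (h : X =ᵐ[P] Y) :
    posExp P X = posExp P Y ∧ negExp P X = negExp P Y :=
  ⟨lintegral_congr_ae (h.mono fun ω hω => by simp only [hω]),
    lintegral_congr_ae (h.mono fun ω hω => by simp only [hω])⟩

end Expectation

/-! ### Relative entropy: comparison with expected log-ratios, and a variational lower bound. -/

section Divergence

variable {Ω : Type*} [MeasurableSpace Ω]

theorem logRatio_of_pos {a b : ℝ} (ha : 0 < a) (hb : 0 < b) :
    logRatio a b = ((Real.log a - Real.log b : ℝ) : EReal) := by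
  rw [logRatio, if_neg hb.ne', if_neg ha.ne', Real.log_div ha.ne' hb.ne']

theorem measurable_logRatio {f q : Ω → ℝ} (hf : Measurable f) (hq : Measurable q) :
    Measurable fun y => logRatio (f y) (q y) := by
  unfold logRatio
  refine Measurable.ite (hq (measurableSet_singleton 0))
    (Measurable.ite (hf (measurableSet_singleton 0)) measurable_const measurable_const)
    (Measurable.ite (hf (measurableSet_singleton 0)) measurable_const ?_)
  exact (Real.measurable_log.comp (hf.div hq)).coe_real_ereal

/-- The relative entropy is bounded by the expected log-likelihood ratio of the densities. -/
theorem klDiv_le_expect_logRatio {μ : Measure Ω} [SigmaFinite μ] {f q : Ω → ℝ}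
    (hf : Measurable f) (hfpos : ∀ y, 0 < f y) (hq : Measurable q) (hq0 : ∀ y, 0 ≤ q y)
    [IsProbabilityMeasure (μ.withDensity fun y => ENNReal.ofReal (f y))]
    (hq1 : ∫⁻ y, ENNReal.ofReal (q y) ∂μ = 1)
    (hdef : ExpDefined (μ.withDensity fun y => ENNReal.ofReal (f y))
      fun y => logRatio (f y) (q y)) :
    (InformationTheory.klDiv (μ.withDensity fun y => ENNReal.ofReal (f y))
      (μ.withDensity fun y => ENNReal.ofReal (q y)) : EReal) ≤
      expect (μ.withDensity fun y => ENNReal.ofReal (f y)) fun y => logRatio (f y) (q y) := by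
  set P := μ.withDensity fun y => ENNReal.ofReal (f y) with hP
  set Q := μ.withDensity fun y => ENNReal.ofReal (q y) with hQ
  have hfm : Measurable fun y => ENNReal.ofReal (f y) := hf.ennreal_ofReal
  have hqm : Measurable fun y => ENNReal.ofReal (q y) := hq.ennreal_ofReal
  have : IsProbabilityMeasure Q := ⟨by
    rw [hQ, withDensity_apply _ MeasurableSet.univ, Measure.restrict_univ, hq1]⟩
  have hlm : Measurable fun y => Real.log (f y) - Real.log (q y) :=
    (Real.measurable_log.comp hf).sub (Real.measurable_log.comp hq)
  by_cases htop : posExp P (fun y => logRatio (f y) (q y)) = ⊤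
  · have hneg : negExp P (fun y => logRatio (f y) (q y)) ≠ ⊤ :=
      hdef.resolve_left (not_not_intro htop)
    rw [expect, htop]
    lift negExp P (fun y => logRatio (f y) (q y)) to NNReal using hneg with p
    simp
  -- Since `f > 0` everywhere, a zero of `q` makes the log-ratio `+∞`; a finite positive part allows
  -- this only on a null set.
  have hqμ : ∀ᵐ y ∂μ, 0 < q y := by
    have h1 : ∀ᵐ y ∂P, (logRatio (f y) (q y)).toENNReal < ⊤ :=
      ae_lt_top (measurable_logRatio hf hq).ereal_toENNReal htop
    rw [hP, ae_withDensity_iff hfm] at h1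
    filter_upwards [h1] with y hy
    have h2 := hy (ENNReal.ofReal_pos.2 (hfpos y)).ne'
    refine lt_of_le_of_ne (hq0 y) fun h0 => ?_
    rw [logRatio, if_pos h0.symm, if_neg (hfpos y).ne'] at h2
    simp at h2
  have hPQ : P = Q.withDensity fun y => ENNReal.ofReal (f y / q y) := by
    have hdm : Measurable fun y => ENNReal.ofReal (f y / q y) := (hf.div hq).ennreal_ofReal
    rw [hQ, ← withDensity_mul _ hqm hdm, hP]
    refine withDensity_congr_ae ?_
    filter_upwards [hqμ] with y hy
    rw [Pi.mul_apply, ← ENNReal.ofReal_mul hy.le, mul_div_cancel₀ _ hy.ne']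
  have hPμ : P ≪ μ := withDensity_absolutelyContinuous _ _
  have hac : P ≪ Q := by
    rw [hPQ]
    exact withDensity_absolutelyContinuous _ _
  have hrn : P.rnDeriv Q =ᵐ[Q] fun y => ENNReal.ofReal (f y / q y) := by
    conv_lhs => rw [hPQ]
    exact Measure.rnDeriv_withDensity Q (hf.div hq).ennreal_ofReal
  have hllr : llr P Q =ᵐ[P] fun y => Real.log (f y) - Real.log (q y) := by
    filter_upwards [hac.ae_le hrn, hPμ.ae_le hqμ] with y hy hy'
    rw [llr, hy, ENNReal.toReal_ofReal (div_nonneg (hfpos y).le hy'.le),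
      Real.log_div (hfpos y).ne' hy'.ne']
  have hX : (fun y => logRatio (f y) (q y)) =ᵐ[P]
      fun y => ((Real.log (f y) - Real.log (q y) : ℝ) : EReal) := by
    filter_upwards [hPμ.ae_le hqμ] with y hy
    exact logRatio_of_pos (hfpos y) hy
  obtain ⟨e1, e2⟩ := posExp_negExp_congr_ae hX
  -- The bound `log x ≤ x` at `x = q / f` shows that the negative part integrates to at most the
  -- total mass of `q`.
  have hneg : negExp P (fun y => ((Real.log (f y) - Real.log (q y) : ℝ) : EReal)) ≠ ⊤ := by
    rw [negExp_coe]
    refine ne_top_of_le_ne_top ENNReal.one_ne_top ?_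
    have hm : Measurable fun y => ENNReal.ofReal (-(Real.log (f y) - Real.log (q y))) :=
      hlm.neg.ennreal_ofReal
    rw [← hq1, hP, lintegral_withDensity_eq_lintegral_mul _ hfm hm]
    refine lintegral_mono_ae ?_
    filter_upwards [hqμ] with y hy
    rw [Pi.mul_apply, ← ENNReal.ofReal_mul (hfpos y).le]
    refine ENNReal.ofReal_le_ofReal ?_
    have h3 : -(Real.log (f y) - Real.log (q y)) ≤ q y / f y := by
      rw [neg_sub, ← Real.log_div hy.ne' (hfpos y).ne']
      exact (Real.log_le_sub_one_of_pos (div_pos hy (hfpos y))).trans (by linarith)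
    calc f y * -(Real.log (f y) - Real.log (q y)) ≤ f y * (q y / f y) :=
          mul_le_mul_of_nonneg_left h3 (hfpos y).le
      _ = q y := mul_div_cancel₀ _ (hfpos y).ne'
  rw [e1] at htop
  have hint := integrable_of_posExp_of_negExp hlm.aestronglyMeasurable htop hneg
  have hint' : Integrable (llr P Q) P := hint.congr hllr.symm
  rw [expect, e1, e2, ← expect, expect_coe hint,
    ← ENNReal.ofReal_toReal (InformationTheory.klDiv_ne_top hac hint'),
    InformationTheory.toReal_klDiv_of_measure_eq hac (by simp), integral_congr_ae hllr]
  have h0 : 0 ≤ ∫ y, (Real.log (f y) - Real.log (q y)) ∂P := by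
    have := InformationTheory.integral_llr_add_sub_measure_univ_nonneg hac hint'
    simpa [integral_congr_ae hllr] using this
  rw [EReal.coe_ennreal_ofReal, max_eq_left h0]

/-- A one-sided Donsker–Varadhan inequality. -/
theorem integral_le_klDiv {P Q : Measure Ω} [IsProbabilityMeasure P] [IsProbabilityMeasure Q]
    {φ : Ω → ℝ} (hφ : Integrable φ P) (hφm : Measurable φ)
    (h1 : ∫⁻ y, ENNReal.ofReal (Real.exp (φ y)) ∂Q ≤ 1) :
    ENNReal.ofReal (∫ y, φ y ∂P) ≤ InformationTheory.klDiv P Q := by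
  by_cases htop : InformationTheory.klDiv P Q = ⊤
  · simp [htop]
  obtain ⟨hac, hint⟩ := InformationTheory.klDiv_ne_top_iff.1 htop
  rw [← ENNReal.ofReal_toReal htop]
  refine ENNReal.ofReal_le_ofReal ?_
  rw [InformationTheory.toReal_klDiv_of_measure_eq hac (by simp), ← sub_nonpos,
    ← integral_sub hφ hint]
  -- Only an inequality, since passing from `Q` to `P` loses the mass of `Q` where `dP/dQ` vanishes.
  -- The conclusion then follows from `x ≤ exp x - 1` at `x = φ - llr`.
  have hlt : ∫⁻ y, ENNReal.ofReal (Real.exp (φ y - llr P Q y)) ∂P ≤ 1 := by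
    refine le_trans ?_ h1
    rw [← lintegral_rnDeriv_mul hac (by
      exact ((hφm.sub (measurable_llr P Q)).exp.ennreal_ofReal).aemeasurable)]
    refine lintegral_mono_ae ?_
    filter_upwards [Measure.rnDeriv_lt_top P Q] with y hy
    by_cases h0 : P.rnDeriv Q y = 0
    · simp [h0]
    have hpos : 0 < (P.rnDeriv Q y).toReal := ENNReal.toReal_pos h0 hy.ne
    rw [llr, Real.exp_sub, Real.exp_log hpos, ← ENNReal.ofReal_toReal hy.ne,
      ENNReal.toReal_ofReal hpos.le, ← ENNReal.ofReal_mul hpos.le, mul_div_cancel₀ _ hpos.ne']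
  have hm : AEStronglyMeasurable (fun y => Real.exp (φ y - llr P Q y)) P :=
    (hφm.sub (measurable_llr P Q)).exp.aestronglyMeasurable
  have hexp : Integrable (fun y => Real.exp (φ y - llr P Q y)) P := by
    refine ⟨hm, ?_⟩
    rw [hasFiniteIntegral_iff_ofReal (ae_of_all _ fun y => (Real.exp_pos _).le)]
    exact hlt.trans_lt ENNReal.one_lt_top
  have h2 : ∫ y, Real.exp (φ y - llr P Q y) ∂P ≤ 1 := by
    rw [integral_eq_lintegral_of_nonneg_ae (ae_of_all _ fun y => (Real.exp_pos _).le) hm]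
    exact ENNReal.toReal_le_of_le_ofReal zero_le_one (by simpa using hlt)
  calc ∫ y, (φ y - llr P Q y) ∂P ≤ ∫ y, (Real.exp (φ y - llr P Q y) - 1) ∂P := by
        refine integral_mono (hφ.sub hint) (hexp.sub (integrable_const 1)) fun y => ?_
        have := Real.add_one_le_exp (φ y - llr P Q y)
        simp only
        linarith
    _ = ∫ y, Real.exp (φ y - llr P Q y) ∂P - 1 := by
        rw [integral_sub hexp (integrable_const 1)]; simp
    _ ≤ 0 := by linarith

end Divergence

end

section

/-! ### Product densities. -/

section Product

variable {Ω : Type*} [MeasurableSpace Ω]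

theorem lintegral_ofReal_prod {n : ℕ} (μ : Measure Ω) [SigmaFinite μ] (f : Fin n → Ω → ℝ)
    (hf : ∀ t, Integrable (f t) μ) (hf0 : ∀ t y, 0 ≤ f t y) :
    ∫⁻ y : Fin n → Ω, ENNReal.ofReal (∏ t, f t (y t)) ∂(Measure.pi fun _ => μ) =
      ∏ t, ENNReal.ofReal (∫ y, f t y ∂μ) := by
  rw [← ofReal_integral_eq_lintegral_ofReal (Integrable.fintype_prod hf)
    (ae_of_all _ fun y => Finset.prod_nonneg fun t _ => hf0 t _),
    integral_fintype_prod_eq_prod, ENNReal.ofReal_prod_of_nonneg]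
  exact fun t _ => integral_nonneg (hf0 t)

theorem pi_withDensity_ofReal {n : ℕ} (μ : Measure Ω) [SigmaFinite μ] {f : Ω → ℝ}
    (hf : Integrable f μ) (hf0 : ∀ y, 0 ≤ f y) :
    (Measure.pi fun _ : Fin n => μ.withDensity fun y => ENNReal.ofReal (f y)) =
      (Measure.pi fun _ : Fin n => μ).withDensity
        fun y => ENNReal.ofReal (∏ t, f (y t)) := by
  have : IsFiniteMeasure (μ.withDensity fun y => ENNReal.ofReal (f y)) :=
    isFiniteMeasure_withDensity_ofReal hf.2
  refine Measure.pi_eq fun s hs => ?_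
  rw [withDensity_apply _ (MeasurableSet.univ_pi hs),
    ← lintegral_indicator (MeasurableSet.univ_pi hs)]
  have h1 : ∀ y : Fin n → Ω, (Set.univ.pi s).indicator
      (fun y => ENNReal.ofReal (∏ t, f (y t))) y =
      ENNReal.ofReal (∏ t, (s t).indicator f (y t)) := by
    intro y
    by_cases hy : y ∈ Set.univ.pi s
    · rw [Set.indicator_of_mem hy]
      congr 1
      exact Finset.prod_congr rfl fun t _ => (Set.indicator_of_mem (hy t trivial) f).symm
    · rw [Set.indicator_of_notMem hy]
      obtain ⟨t, ht⟩ : ∃ t, y t ∉ s t := by simpa [Set.mem_pi] using hy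
      rw [Finset.prod_eq_zero (Finset.mem_univ t) (Set.indicator_of_notMem ht f),
        ENNReal.ofReal_zero]
  simp_rw [h1]
  rw [lintegral_ofReal_prod μ (fun t => (s t).indicator f) (fun t => hf.indicator (hs t))
    fun t y => Set.indicator_nonneg (fun y _ => hf0 y) y]
  refine Finset.prod_congr rfl fun t _ => ?_
  rw [withDensity_apply _ (hs t), integral_indicator (hs t),
    ofReal_integral_eq_lintegral_ofReal hf.restrict (ae_of_all _ hf0)]

end Product

/-! ### Gaussian integrals in terms of sample mean and scatter. -/

section Gaussian

variable {d n : ℕ}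

theorem integrable_exp_neg_mul_sq_norm {b : ℝ} (hb : 0 < b) :
    Integrable fun x : EuclideanSpace ℝ (Fin d) => Real.exp (-b * ‖x‖ ^ 2) := by
  have h := GaussianFourier.integrable_cexp_neg_mul_sq_norm_add (V := EuclideanSpace ℝ (Fin d))
    (b := (b : ℂ)) (by simpa using hb) 0 0
  refine h.re.congr (ae_of_all _ fun x => ?_)
  simp only [inner_zero_left, Complex.ofReal_zero, mul_zero, add_zero]
  rw [show -(b : ℂ) * (‖x‖ : ℂ) ^ 2 = ((-b * ‖x‖ ^ 2 : ℝ) : ℂ) by push_cast; ring]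
  exact Complex.exp_ofReal_re _

theorem integral_exp_neg_mul_sq_norm {b : ℝ} (hb : 0 < b) :
    ∫ x : EuclideanSpace ℝ (Fin d), Real.exp (-b * ‖x‖ ^ 2) = (Real.pi / b) ^ ((d : ℝ) / 2) := by
  simpa using GaussianFourier.integral_rexp_neg_mul_sq_norm (V := EuclideanSpace ℝ (Fin d)) hb

theorem lintegral_exp_neg_mul_sq_norm {b : ℝ} (hb : 0 < b) :
    ∫⁻ x : EuclideanSpace ℝ (Fin d), ENNReal.ofReal (Real.exp (-b * ‖x‖ ^ 2)) =
      ENNReal.ofReal ((Real.pi / b) ^ ((d : ℝ) / 2)) := by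
  rw [← ofReal_integral_eq_lintegral_ofReal (integrable_exp_neg_mul_sq_norm hb)
    (ae_of_all _ fun x => (Real.exp_pos _).le), integral_exp_neg_mul_sq_norm hb]

theorem lintegral_exp_neg_mul_sum_sq_norm {b : ℝ} (hb : 0 < b) :
    ∫⁻ z : Fin n → EuclideanSpace ℝ (Fin d),
        ENNReal.ofReal (Real.exp (-b * ∑ t, ‖z t‖ ^ 2)) =
      ENNReal.ofReal ((Real.pi / b) ^ ((n : ℝ) * d / 2)) := by
  have h := lintegral_ofReal_prod (n := n) (volume : Measure (EuclideanSpace ℝ (Fin d)))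
    (fun _ x => Real.exp (-b * ‖x‖ ^ 2)) (fun _ => integrable_exp_neg_mul_sq_norm hb)
    fun _ x => (Real.exp_pos _).le
  simp only [← Real.exp_sum, ← Finset.mul_sum, ← volume_pi] at h
  rw [h, integral_exp_neg_mul_sq_norm hb, Finset.prod_const, Finset.card_univ, Fintype.card_fin,
    ← ENNReal.ofReal_pow (by positivity), ← Real.rpow_mul_natCast (by positivity)]
  congr 2
  ring

/-- The total squared deviation from the sample mean. -/
noncomputable def scatter (y : Fin n → EuclideanSpace ℝ (Fin d)) : ℝ :=
  ∑ t, ‖y t - sampleMean y‖ ^ 2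

theorem scatter_nonneg (y : Fin n → EuclideanSpace ℝ (Fin d)) : 0 ≤ scatter y :=
  Finset.sum_nonneg fun _ _ => by positivity

theorem continuous_sampleMean :
    Continuous (sampleMean : (Fin n → EuclideanSpace ℝ (Fin d)) → EuclideanSpace ℝ (Fin d)) := by
  unfold sampleMean
  fun_prop

theorem measurable_sampleMean :
    Measurable
      (sampleMean : (Fin n → EuclideanSpace ℝ (Fin d)) → EuclideanSpace ℝ (Fin d)) :=
  continuous_sampleMean.measurable

theorem continuous_scatter :
    Continuous (scatter : (Fin n → EuclideanSpace ℝ (Fin d)) → ℝ) := by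
  unfold scatter
  have := continuous_sampleMean (d := d) (n := n)
  fun_prop

theorem measurable_scatter :
    Measurable (scatter : (Fin n → EuclideanSpace ℝ (Fin d)) → ℝ) :=
  continuous_scatter.measurable

theorem sum_sq_norm_sub (hn : 1 ≤ n) (y : Fin n → EuclideanSpace ℝ (Fin d))
    (u : EuclideanSpace ℝ (Fin d)) :
    ∑ t, ‖y t - u‖ ^ 2 = scatter y + n * ‖sampleMean y - u‖ ^ 2 := by
  have hn0 : (n : ℝ) ≠ 0 := by positivity
  have h0 : ∑ t, (y t - sampleMean y) = 0 := by
    rw [Finset.sum_sub_distrib, Finset.sum_const, Finset.card_univ, Fintype.card_fin,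
      sampleMean, ← Nat.cast_smul_eq_nsmul ℝ, smul_smul, mul_inv_cancel₀ hn0, one_smul, sub_self]
  have h1 : ∀ t, ‖y t - u‖ ^ 2 = ‖y t - sampleMean y‖ ^ 2 +
      2 * inner ℝ (y t - sampleMean y) (sampleMean y - u) + ‖sampleMean y - u‖ ^ 2 := by
    intro t
    rw [← norm_add_sq_real, sub_add_sub_cancel]
  simp_rw [h1]
  rw [Finset.sum_add_distrib, Finset.sum_add_distrib, ← Finset.mul_sum, ← sum_inner, h0,
    inner_zero_left]
  simp [scatter]

theorem sampleMean_add_const (hn : 1 ≤ n) (z : Fin n → EuclideanSpace ℝ (Fin d))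
    (u : EuclideanSpace ℝ (Fin d)) :
    sampleMean (z + fun _ => u) = sampleMean z + u := by
  have hn0 : (n : ℝ) ≠ 0 := by positivity
  simp only [sampleMean, Pi.add_apply, Finset.sum_add_distrib, Finset.sum_const,
    Finset.card_univ, Fintype.card_fin, smul_add]
  rw [← Nat.cast_smul_eq_nsmul ℝ, smul_smul, inv_mul_cancel₀ hn0, one_smul]

/-- Integration against a Gaussian weight in the deviations from the sample mean. -/
theorem lintegral_exp_scatter_mul (hn : 1 ≤ n) {s : ℝ} (hs : 0 < s)
    {φ : EuclideanSpace ℝ (Fin d) → ℝ≥0∞} (hφ : Measurable φ) :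
    ∫⁻ y : Fin n → EuclideanSpace ℝ (Fin d),
        ENNReal.ofReal (Real.exp (-(s / 2) * scatter y)) * φ (sampleMean y) =
      ENNReal.ofReal ((n : ℝ) ^ ((d : ℝ) / 2) * (2 * Real.pi / s) ^ (((n : ℝ) - 1) * d / 2)) *
        ∫⁻ x, φ x := by
  have hn0 : (0 : ℝ) < n := by exact_mod_cast hn
  have hsn : 0 < s * n / 2 := by positivity
  set c : ℝ := (Real.pi / (s * n / 2)) ^ ((d : ℝ) / 2) with hc
  have hcpos : 0 < c := by positivity
  have hmean : Measurable (sampleMean : (Fin n → EuclideanSpace ℝ (Fin d)) → _) :=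
    measurable_sampleMean
  have hshift : ∀ x : EuclideanSpace ℝ (Fin d),
      ∫⁻ u, ENNReal.ofReal (Real.exp (-(s * n / 2) * ‖x - u‖ ^ 2)) = ENNReal.ofReal c := by
    intro x
    rw [lintegral_sub_left_eq_self
      (fun v => ENNReal.ofReal (Real.exp (-(s * n / 2) * ‖v‖ ^ 2))) x,
      lintegral_exp_neg_mul_sq_norm hsn]
  -- Instead of an orthogonal change of variables, the constant `c` is written as a Gaussian
  -- integral over an auxiliary point `u`. It turns the scatter into `∑ₜ ‖yₜ - u‖²`. After the shift
  -- `y = z + u`, the variable `u` occurs only in `φ (z̄ + u)` and integrates out by translation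
  -- invariance.
  have hkey : ENNReal.ofReal c * ∫⁻ y : Fin n → EuclideanSpace ℝ (Fin d),
        ENNReal.ofReal (Real.exp (-(s / 2) * scatter y)) * φ (sampleMean y) =
      ENNReal.ofReal ((Real.pi / (s / 2)) ^ ((n : ℝ) * d / 2)) * ∫⁻ x, φ x := by
    calc
      _ = ∫⁻ y : Fin n → EuclideanSpace ℝ (Fin d), ∫⁻ u,
          ENNReal.ofReal (Real.exp (-(s / 2) * ∑ t, ‖y t - u‖ ^ 2)) * φ (sampleMean y) := by
        rw [← lintegral_const_mul' _ _ ENNReal.ofReal_ne_top]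
        refine lintegral_congr fun y => ?_
        rw [← hshift (sampleMean y), mul_comm, ← lintegral_const_mul]
        · refine lintegral_congr fun u => ?_
          rw [sum_sq_norm_sub hn, mul_add, Real.exp_add,
            ENNReal.ofReal_mul (Real.exp_pos _).le,
            show -(s / 2) * (n * ‖sampleMean y - u‖ ^ 2) = -(s * n / 2) * ‖sampleMean y - u‖ ^ 2
              by ring]
          ring
        · fun_prop
      _ = ∫⁻ u, ∫⁻ y : Fin n → EuclideanSpace ℝ (Fin d),
          ENNReal.ofReal (Real.exp (-(s / 2) * ∑ t, ‖y t - u‖ ^ 2)) * φ (sampleMean y) := by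
        rw [lintegral_lintegral_swap]
        refine Measurable.aemeasurable ?_
        simp only [Function.uncurry_def]
        refine Measurable.mul ?_ (hφ.comp (hmean.comp measurable_fst))
        refine Measurable.ennreal_ofReal (Continuous.measurable ?_)
        fun_prop
      _ = ∫⁻ u, ∫⁻ z : Fin n → EuclideanSpace ℝ (Fin d),
          ENNReal.ofReal (Real.exp (-(s / 2) * ∑ t, ‖z t‖ ^ 2)) * φ (sampleMean z + u) := by
        refine lintegral_congr fun u => ?_
        rw [← lintegral_add_right_eq_self _ (fun _ => u)]
        refine lintegral_congr fun z => ?_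
        simp only [sampleMean_add_const hn, Pi.add_apply, add_sub_cancel_right]
      _ = ∫⁻ z : Fin n → EuclideanSpace ℝ (Fin d), ∫⁻ u,
          ENNReal.ofReal (Real.exp (-(s / 2) * ∑ t, ‖z t‖ ^ 2)) * φ (sampleMean z + u) := by
        rw [lintegral_lintegral_swap]
        refine Measurable.aemeasurable ?_
        simp only [Function.uncurry_def]
        refine Measurable.mul ?_
          (hφ.comp ((hmean.comp measurable_snd).add measurable_fst))
        refine Measurable.ennreal_ofReal (Continuous.measurable ?_)
        fun_prop
      _ = ∫⁻ z : Fin n → EuclideanSpace ℝ (Fin d),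
          ENNReal.ofReal (Real.exp (-(s / 2) * ∑ t, ‖z t‖ ^ 2)) * ∫⁻ x, φ x := by
        refine lintegral_congr fun z => ?_
        rw [lintegral_const_mul' _ _ ENNReal.ofReal_ne_top, lintegral_add_left_eq_self]
      _ = _ := by
        rw [lintegral_mul_const, lintegral_exp_neg_mul_sum_sq_norm (by positivity)]
        exact (Continuous.measurable (by fun_prop)).ennreal_ofReal
  have hc0 : ENNReal.ofReal c ≠ 0 := (ENNReal.ofReal_pos.2 hcpos).ne'
  rw [← ENNReal.mul_right_inj hc0 ENNReal.ofReal_ne_top, hkey, ← mul_assoc,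
    ← ENNReal.ofReal_mul hcpos.le]
  congr 2
  rw [hc, show Real.pi / (s * n / 2) = (2 * Real.pi / s) / n by field_simp,
    show Real.pi / (s / 2) = 2 * Real.pi / s by field_simp,
    Real.div_rpow (by positivity) hn0.le, ← mul_assoc,
    div_mul_cancel₀ _ (by positivity), ← Real.rpow_add (by positivity)]
  congr 1
  ring

theorem continuous_gaussDensity (θ : EuclideanSpace ℝ (Fin d)) :
    Continuous (gaussDensity θ) := by
  unfold gaussDensity
  fun_prop

theorem gaussDensity_pos (θ y : EuclideanSpace ℝ (Fin d)) : 0 < gaussDensity θ y := by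
  unfold gaussDensity
  positivity

theorem integrable_gaussDensity (θ : EuclideanSpace ℝ (Fin d)) :
    Integrable (gaussDensity θ) := by
  unfold gaussDensity
  exact ((integrable_exp_neg_mul_sq_norm (d := d) (b := 1 / 2)
    (by norm_num)).comp_sub_right θ).const_mul _

theorem integral_gaussDensity (θ : EuclideanSpace ℝ (Fin d)) : ∫ y, gaussDensity θ y = 1 := by
  unfold gaussDensity
  rw [integral_const_mul, integral_sub_right_eq_self
    (fun x : EuclideanSpace ℝ (Fin d) => Real.exp (-(1 / 2) * ‖x‖ ^ 2)) θ,
    integral_exp_neg_mul_sq_norm (by norm_num),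
    show Real.pi / (1 / 2) = 2 * Real.pi by ring, ← Real.rpow_add (by positivity),
    neg_div, neg_add_cancel, Real.rpow_zero]

/-- The Gaussian law with identity covariance and mean `θ`. -/
noncomputable def gaussLaw (θ : EuclideanSpace ℝ (Fin d)) :
    Measure (EuclideanSpace ℝ (Fin d)) :=
  volume.withDensity fun y => ENNReal.ofReal (gaussDensity θ y)

instance (θ : EuclideanSpace ℝ (Fin d)) : IsProbabilityMeasure (gaussLaw θ) := by
  refine ⟨?_⟩
  rw [gaussLaw, withDensity_apply _ MeasurableSet.univ, Measure.restrict_univ,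
    ← ofReal_integral_eq_lintegral_ofReal (integrable_gaussDensity θ)
    (ae_of_all _ fun y => (gaussDensity_pos θ y).le), integral_gaussDensity, ENNReal.ofReal_one]

theorem prod_gaussDensity (hn : 1 ≤ n) (θ : EuclideanSpace ℝ (Fin d))
    (y : Fin n → EuclideanSpace ℝ (Fin d)) :
    ∏ t, gaussDensity θ (y t) = (2 * Real.pi) ^ (-((n : ℝ) * d) / 2) *
      Real.exp (-(1 / 2) * (scatter y + n * ‖sampleMean y - θ‖ ^ 2)) := by
  simp only [gaussDensity]
  rw [Finset.prod_mul_distrib, ← Real.exp_sum, ← Finset.mul_sum, sum_sq_norm_sub hn,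
    Finset.prod_const, Finset.card_univ, Fintype.card_fin,
    ← Real.rpow_mul_natCast (by positivity)]
  congr 2
  ring

theorem pi_gaussLaw (θ : EuclideanSpace ℝ (Fin d)) :
    (Measure.pi fun _ : Fin n => gaussLaw θ) =
      volume.withDensity fun y => ENNReal.ofReal (∏ t, gaussDensity θ (y t)) := by
  unfold gaussLaw
  rw [pi_withDensity_ofReal volume (integrable_gaussDensity θ) fun y => (gaussDensity_pos θ y).le, volume_pi]

/-- The sample mean has law `N(θ, I/n)`: the likelihood splits into a factor in the scatter and a
factor in the mean, and the scatter integrates out. -/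
theorem lintegral_sampleMean_gaussLaw (hn : 1 ≤ n) (θ : EuclideanSpace ℝ (Fin d))
    {φ : EuclideanSpace ℝ (Fin d) → ℝ≥0∞} (hφ : Measurable φ) :
    ∫⁻ y, φ (sampleMean y) ∂(Measure.pi fun _ : Fin n => gaussLaw θ) =
      ENNReal.ofReal ((n / (2 * Real.pi)) ^ ((d : ℝ) / 2)) *
        ∫⁻ x, ENNReal.ofReal (Real.exp (-(n / 2) * ‖x - θ‖ ^ 2)) * φ x := by
  have hn0 : (0 : ℝ) < n := by exact_mod_cast hn
  have hm : Measurable fun x : EuclideanSpace ℝ (Fin d) =>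
      ENNReal.ofReal (Real.exp (-(n / 2) * ‖x - θ‖ ^ 2)) * φ x := by fun_prop
  have hp : Measurable fun y : Fin n → EuclideanSpace ℝ (Fin d) =>
      ENNReal.ofReal (∏ t, gaussDensity θ (y t)) := by
    have := continuous_gaussDensity θ
    exact (Continuous.measurable (by fun_prop)).ennreal_ofReal
  have hφ' : Measurable fun y : Fin n → EuclideanSpace ℝ (Fin d) => φ (sampleMean y) :=
    hφ.comp measurable_sampleMean
  rw [pi_gaussLaw, lintegral_withDensity_eq_lintegral_mul _ hp hφ']
  have h1 : ∀ y : Fin n → EuclideanSpace ℝ (Fin d),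
      ENNReal.ofReal (∏ t, gaussDensity θ (y t)) * φ (sampleMean y) =
      ENNReal.ofReal ((2 * Real.pi) ^ (-((n : ℝ) * d) / 2)) *
        (ENNReal.ofReal (Real.exp (-(1 / 2) * scatter y)) *
        (ENNReal.ofReal (Real.exp (-(n / 2) * ‖sampleMean y - θ‖ ^ 2)) *
          φ (sampleMean y))) := by
    intro y
    rw [prod_gaussDensity hn, mul_add, Real.exp_add,
      ENNReal.ofReal_mul (by positivity), ENNReal.ofReal_mul (by positivity),
      show -(1 / 2) * (n * ‖sampleMean y - θ‖ ^ 2) = -(n / 2) * ‖sampleMean y - θ‖ ^ 2 by ring]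
    ring
  have h2 := lintegral_exp_scatter_mul hn one_pos hm
  simp only [Pi.mul_apply]
  rw [lintegral_congr h1, lintegral_const_mul' _ _ ENNReal.ofReal_ne_top, h2, ← mul_assoc,
    ← ENNReal.ofReal_mul (by positivity)]
  congr 2
  rw [div_one, mul_left_comm, ← Real.rpow_add (by positivity),
    show -((n : ℝ) * d) / 2 + (n - 1) * d / 2 = -((d : ℝ) / 2) by ring,
    Real.div_rpow hn0.le (by positivity), Real.rpow_neg (by positivity), ← div_eq_mul_inv]

end Gaussian

end

/-! ### Lower bounds for the capacity and the two regrets. -/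

section

variable {d n : ℕ}

/-- The Laplace transform of a chi-square variable with `d` degrees of freedom; it supplies both the
integrability and the size of the second moment. -/
theorem lintegral_exp_mul_sq_norm_gaussLaw (hn : 1 ≤ n) (θ : EuclideanSpace ℝ (Fin d)) {t : ℝ}
    (ht : t < 1) :
    ∫⁻ y, ENNReal.ofReal (Real.exp (t * (n / 2 * ‖sampleMean y - θ‖ ^ 2)))
        ∂(Measure.pi fun _ : Fin n => gaussLaw θ) =
      ENNReal.ofReal ((1 - t) ^ (-((d : ℝ) / 2))) := by
  have hn0 : (0 : ℝ) < n := by exact_mod_cast hn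
  have ht' : 0 < 1 - t := by linarith
  have hb : 0 < (1 - t) * (n / 2) := by positivity
  rw [lintegral_sampleMean_gaussLaw hn θ
    (φ := fun x => ENNReal.ofReal (Real.exp (t * (n / 2 * ‖x - θ‖ ^ 2)))) (by fun_prop)]
  have h1 : ∀ x : EuclideanSpace ℝ (Fin d), ENNReal.ofReal (Real.exp (-(n / 2) * ‖x - θ‖ ^ 2)) *
      ENNReal.ofReal (Real.exp (t * (n / 2 * ‖x - θ‖ ^ 2))) =
      ENNReal.ofReal (Real.exp (-((1 - t) * (n / 2)) * ‖x - θ‖ ^ 2)) := by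
    intro x
    rw [← ENNReal.ofReal_mul (Real.exp_pos _).le, ← Real.exp_add]
    congr 2
    ring
  simp_rw [h1]
  rw [lintegral_sub_right_eq_self
    (fun x : EuclideanSpace ℝ (Fin d) =>
      ENNReal.ofReal (Real.exp (-((1 - t) * (n / 2)) * ‖x‖ ^ 2))) θ,
    lintegral_exp_neg_mul_sq_norm hb, ← ENNReal.ofReal_mul (by positivity),
    ← Real.mul_rpow (by positivity) (by positivity), Real.rpow_neg ht'.le,
    ← Real.inv_rpow ht'.le]
  congr 2
  field_simp

theorem integrable_sq_norm_gaussLaw (hn : 1 ≤ n) (θ : EuclideanSpace ℝ (Fin d)) :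
    Integrable (fun y => (n : ℝ) / 2 * ‖sampleMean y - θ‖ ^ 2)
      (Measure.pi fun _ : Fin n => gaussLaw θ) := by
  have hn0 : (0 : ℝ) < n := by exact_mod_cast hn
  have hmean : Continuous (sampleMean : (Fin n → EuclideanSpace ℝ (Fin d)) → _) :=
    continuous_sampleMean
  refine ⟨(Continuous.measurable (by fun_prop)).aestronglyMeasurable, ?_⟩
  rw [hasFiniteIntegral_iff_ofReal (ae_of_all _ fun y => by positivity)]
  have h2 := lintegral_exp_mul_sq_norm_gaussLaw hn θ (t := 1 / 2) (by norm_num)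
  have h3 : ∫⁻ y, ENNReal.ofReal 2 *
      ENNReal.ofReal (Real.exp (1 / 2 * (n / 2 * ‖sampleMean y - θ‖ ^ 2)))
      ∂(Measure.pi fun _ : Fin n => gaussLaw θ) < ⊤ := by
    rw [lintegral_const_mul' _ _ ENNReal.ofReal_ne_top, h2]
    exact ENNReal.mul_lt_top ENNReal.ofReal_lt_top ENNReal.ofReal_lt_top
  refine lt_of_le_of_lt (lintegral_mono fun y => ?_) h3
  rw [← ENNReal.ofReal_mul zero_le_two]
  refine ENNReal.ofReal_le_ofReal ?_
  have := Real.add_one_le_exp (1 / 2 * ((n : ℝ) / 2 * ‖sampleMean y - θ‖ ^ 2))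
  linarith

/-- By `1 + x ≤ exp x`, the line `1 + tI` lies below the Laplace transform `(1 - t)^(-d/2)`. The two
agree at `t = 0`, so `I` is at most the derivative there. -/
theorem integral_sq_norm_gaussLaw_le (hn : 1 ≤ n) (θ : EuclideanSpace ℝ (Fin d)) :
    ∫ y, (n : ℝ) / 2 * ‖sampleMean y - θ‖ ^ 2 ∂(Measure.pi fun _ : Fin n => gaussLaw θ) ≤
      (d : ℝ) / 2 := by
  set I := ∫ y, (n : ℝ) / 2 * ‖sampleMean y - θ‖ ^ 2 ∂(Measure.pi fun _ : Fin n => gaussLaw θ)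
    with hI
  have hint := integrable_sq_norm_gaussLaw hn θ
  have hmean : Continuous (sampleMean : (Fin n → EuclideanSpace ℝ (Fin d)) → _) :=
    continuous_sampleMean
  have hbound : ∀ t : ℝ, t < 1 → t * I + 1 ≤ (1 - t) ^ (-((d : ℝ) / 2)) := by
    intro t ht
    have h1 := lintegral_exp_mul_sq_norm_gaussLaw hn θ ht
    have hm : Measurable fun y : Fin n → EuclideanSpace ℝ (Fin d) =>
        Real.exp (t * (n / 2 * ‖sampleMean y - θ‖ ^ 2)) := Continuous.measurable (by fun_prop)
    have hexp : Integrable (fun y => Real.exp (t * (n / 2 * ‖sampleMean y - θ‖ ^ 2)))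
        (Measure.pi fun _ : Fin n => gaussLaw θ) := by
      refine ⟨hm.aestronglyMeasurable, ?_⟩
      rw [hasFiniteIntegral_iff_ofReal (ae_of_all _ fun y => (Real.exp_pos _).le), h1]
      exact ENNReal.ofReal_lt_top
    have h2 : ∫ y, Real.exp (t * (n / 2 * ‖sampleMean y - θ‖ ^ 2))
        ∂(Measure.pi fun _ : Fin n => gaussLaw θ) = (1 - t) ^ (-((d : ℝ) / 2)) := by
      rw [integral_eq_lintegral_of_nonneg_ae (ae_of_all _ fun y => (Real.exp_pos _).le)
        hm.aestronglyMeasurable, h1,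
        ENNReal.toReal_ofReal (Real.rpow_nonneg (by linarith) _)]
    rw [← h2]
    have h3 : t * I + 1 = ∫ y, (t * (n / 2 * ‖sampleMean y - θ‖ ^ 2) + 1)
        ∂(Measure.pi fun _ : Fin n => gaussLaw θ) := by
      rw [integral_add (hint.const_mul t) (integrable_const 1), integral_const_mul]
      simp [hI]
    rw [h3]
    exact integral_mono ((hint.const_mul t).add (integrable_const 1)) hexp
      fun y => Real.add_one_le_exp _
  have hderiv : HasDerivAt (fun t : ℝ => (1 - t) ^ (-((d : ℝ) / 2))) ((d : ℝ) / 2) 0 := by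
    have h := ((hasDerivAt_id (0 : ℝ)).const_sub 1).rpow_const (p := -((d : ℝ) / 2))
      (Or.inl (by norm_num))
    simpa using h
  have hlim := hderiv.tendsto_slope_zero_right
  refine ge_of_tendsto hlim ?_
  have : Set.Ioo (0 : ℝ) 1 ∈ 𝓝[>] (0 : ℝ) := Ioo_mem_nhdsGT one_pos
  filter_upwards [this] with t ht
  have h4 := hbound t ht.2
  simp only [zero_add, sub_zero, Real.one_rpow, smul_eq_mul]
  rw [inv_mul_eq_div, le_div_iff₀ ht.1]
  linarith

/-- The test function is `log(κV) - (n/2)‖ȳ - θ‖²`, where `κ` normalizes the density of `N(θ, I/n)`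
and `V` is the volume of `Θ`. Its mean under the model is at least the claimed value. Its
exponential moment under `Q` is at most one for some `θ`, because this holds on average over `Θ`. -/
theorem ofReal_le_capacity (hn : 1 ≤ n) {Θ : Set (EuclideanSpace ℝ (Fin d))}
    (hΘ : IsCompact Θ) (hpos : 0 < volume Θ) :
    ENNReal.ofReal ((d : ℝ) / 2 * Real.log (n / (2 * Real.pi)) - d / 2 +
      Real.log (volume Θ).toReal) ≤ capacity gaussDensity Θ volume n := by
  have hn0 : (0 : ℝ) < n := by exact_mod_cast hn
  have hfin : volume Θ ≠ ⊤ := hΘ.measure_lt_top.ne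
  set V := (volume Θ).toReal with hV
  have hVpos : 0 < V := ENNReal.toReal_pos hpos.ne' hfin
  have hmean : Continuous (sampleMean : (Fin n → EuclideanSpace ℝ (Fin d)) → _) :=
    continuous_sampleMean
  refine le_iInf₂ fun Q hQ => ?_
  set κ : ℝ := (n / (2 * Real.pi)) ^ ((d : ℝ) / 2) with hκ
  have hκpos : 0 < κ := by positivity
  let g : EuclideanSpace ℝ (Fin d) → ℝ≥0∞ := fun θ =>
    ∫⁻ y, ENNReal.ofReal (κ * V * Real.exp (-(n / 2) * ‖sampleMean y - θ‖ ^ 2)) ∂Q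
  have hjoint : Measurable fun p : EuclideanSpace ℝ (Fin d) × (Fin n → EuclideanSpace ℝ (Fin d)) =>
      ENNReal.ofReal (κ * V * Real.exp (-(n / 2) * ‖sampleMean p.2 - p.1‖ ^ 2)) :=
    (Continuous.measurable (by fun_prop)).ennreal_ofReal
  have hgm : Measurable g := hjoint.lintegral_prod_right'
  -- For fixed `y`, `κ exp(-(n/2)‖ȳ - θ‖²)` is a probability density in `θ` as well, so its integral
  -- over `Θ` is at most one; dividing by `V` cancels the factor `V` in `g`.
  have hg : ⨍⁻ θ in Θ, g θ ∂volume ≤ 1 := by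
    rw [setLAverage_eq]
    refine ENNReal.div_le_of_le_mul ?_
    rw [one_mul, lintegral_lintegral_swap hjoint.aemeasurable]
    have h1 : ∀ y : Fin n → EuclideanSpace ℝ (Fin d), ∫⁻ θ in Θ,
        ENNReal.ofReal (κ * V * Real.exp (-(n / 2) * ‖sampleMean y - θ‖ ^ 2)) ≤ volume Θ := by
      intro y
      refine (setLIntegral_le_lintegral _ _).trans_eq ?_
      simp_rw [ENNReal.ofReal_mul (mul_pos hκpos hVpos).le]
      rw [lintegral_const_mul' _ _ ENNReal.ofReal_ne_top, lintegral_sub_left_eq_self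
        (fun v => ENNReal.ofReal (Real.exp (-(n / 2) * ‖v‖ ^ 2))) (sampleMean y),
        lintegral_exp_neg_mul_sq_norm (by positivity), ← ENNReal.ofReal_mul (by positivity),
        mul_right_comm, hκ, ← Real.mul_rpow (by positivity) (by positivity),
        show (n : ℝ) / (2 * Real.pi) * (Real.pi / (n / 2)) = 1 by field_simp, Real.one_rpow,
        one_mul, hV, ENNReal.ofReal_toReal hfin]
    calc _ ≤ ∫⁻ _, volume Θ ∂Q := lintegral_mono h1
      _ = volume Θ := by simp
  obtain ⟨θ, hθ, hle⟩ := exists_le_setLAverage hpos.ne' hfin hgm.aemeasurable.restrict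
  refine le_trans ?_ (le_iSup₂_of_le θ hθ le_rfl)
  let φ : (Fin n → EuclideanSpace ℝ (Fin d)) → ℝ := fun y =>
    ((d : ℝ) / 2 * Real.log (n / (2 * Real.pi)) + Real.log V) -
      n / 2 * ‖sampleMean y - θ‖ ^ 2
  have hint := integrable_sq_norm_gaussLaw hn θ
  have hφint : Integrable φ (Measure.pi fun _ : Fin n => gaussLaw θ) :=
    (integrable_const _).sub hint
  have hφm : Measurable φ := Continuous.measurable (by fun_prop)
  refine le_trans (ENNReal.ofReal_le_ofReal ?_)
    (integral_le_klDiv (P := Measure.pi fun _ : Fin n => gaussLaw θ) (Q := Q) hφint hφm ?_)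
  · have h2 := integral_sq_norm_gaussLaw_le hn θ
    simp only [φ]
    rw [integral_sub (integrable_const _) hint]
    simp only [integral_const, probReal_univ, one_smul]
    linarith
  · refine le_trans (le_of_eq ?_) (hle.trans hg)
    refine lintegral_congr fun y => ?_
    congr 1
    simp only [φ]
    rw [Real.exp_sub, Real.exp_add, Real.exp_log hVpos, hκ, Real.rpow_def_of_pos (by positivity),
      neg_mul, Real.exp_neg, div_eq_mul_inv, mul_comm (Real.log _)]

theorem coe_le_capacity (hn : 1 ≤ n) {Θ : Set (EuclideanSpace ℝ (Fin d))}
    (hΘ : IsCompact Θ) (hpos : 0 < volume Θ) :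
    (((d : ℝ) / 2 * Real.log (n / (2 * Real.pi)) - d / 2 +
      Real.log (volume Θ).toReal : ℝ) : EReal) ≤ (capacity gaussDensity Θ volume n : EReal) := by
  refine le_trans ?_ (EReal.coe_ennreal_le_coe_ennreal_iff.2 (ofReal_le_capacity hn hΘ hpos))
  rw [EReal.coe_ennreal_ofReal]
  exact_mod_cast le_max_left _ _

/-- The supremum over iid laws includes the model law of each `θ`, where the expected regret
dominates the divergence from `q`. -/
theorem capacity_le_worstRegret {Θ : Set (EuclideanSpace ℝ (Fin d))} (hne : Θ.Nonempty)
    {q : (Fin n → EuclideanSpace ℝ (Fin d)) → ℝ} (hq : IsDensity volume n q)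
    (hadm : Admissible gaussDensity Θ (iidLaws (EuclideanSpace ℝ (Fin d)) n) q) :
    (capacity gaussDensity Θ volume n : EReal) ≤
      worstRegret gaussDensity Θ (iidLaws (EuclideanSpace ℝ (Fin d)) n) q := by
  obtain ⟨hqm, hq0, hq1⟩ := hq
  rw [← volume_pi] at hq1
  let Q : Measure (Fin n → EuclideanSpace ℝ (Fin d)) :=
    volume.withDensity fun y => ENNReal.ofReal (q y)
  have hQ : IsProbabilityMeasure Q := ⟨by
    simp only [Q]
    rw [withDensity_apply _ MeasurableSet.univ, Measure.restrict_univ, hq1]⟩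
  have h1 : ∀ θ ∈ Θ, (InformationTheory.klDiv (Measure.pi fun _ : Fin n => gaussLaw θ) Q : EReal)
      ≤ worstRegret gaussDensity Θ (iidLaws (EuclideanSpace ℝ (Fin d)) n) q := by
    intro θ hθ
    have hmem : (Measure.pi fun _ : Fin n => gaussLaw θ) ∈
      iidLaws (EuclideanSpace ℝ (Fin d)) n := ⟨gaussLaw θ, inferInstance, rfl⟩
    refine le_trans ?_ (le_iSup₂_of_le _ hmem (le_iSup₂_of_le θ hθ le_rfl))
    have hdef := hadm _ hmem θ hθ
    have hprob : IsProbabilityMeasure (Measure.pi fun _ : Fin n => gaussLaw θ) := inferInstance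
    unfold regretAt at *
    rw [pi_gaussLaw] at *
    refine klDiv_le_expect_logRatio ?_ (fun y => Finset.prod_pos fun t _ => gaussDensity_pos θ _)
      hqm hq0 hq1 hdef
    have := continuous_gaussDensity θ
    exact Continuous.measurable (by fun_prop)
  have h2 : capacity gaussDensity Θ volume n ≤ ⨆ θ ∈ Θ,
      InformationTheory.klDiv (Measure.pi fun _ : Fin n => gaussLaw θ) Q :=
    iInf₂_le Q hQ
  refine le_trans (EReal.coe_ennreal_le_coe_ennreal_iff.2 h2) ?_
  obtain ⟨θ₀, hθ₀⟩ := hne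
  -- Nonnegativity, obtained from a single `θ₀`, permits the comparison to be made in `ℝ≥0∞`, where
  -- the supremum defining the capacity is taken.
  have h0 : 0 ≤ worstRegret gaussDensity Θ (iidLaws (EuclideanSpace ℝ (Fin d)) n) q :=
    (EReal.coe_ennreal_nonneg _).trans (h1 θ₀ hθ₀)
  rw [← EReal.coe_toENNReal h0]
  refine EReal.coe_ennreal_le_coe_ennreal_iff.2 (iSup₂_le fun θ hθ => ?_)
  rw [← EReal.coe_ennreal_le_coe_ennreal_iff, EReal.coe_toENNReal h0]
  exact h1 θ hθ

theorem capacity_le_pacRegret {Θ : Set (EuclideanSpace ℝ (Fin d))} (hΘ : Θ.Nonempty) :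
    (capacity gaussDensity Θ volume n : EReal) ≤ pacRegret gaussDensity Θ volume n :=
  le_iInf₂ fun _ hq => capacity_le_worstRegret hΘ hq.1 hq.2

/-- Shtarkov's argument: `exp(regret) · q` dominates the maximized likelihood. On `ȳ ∈ Θ` the
maximizer is `ȳ` itself and only the scatter remains, so integrating over this event gives
`Vol(Θ)(n/2π)^(d/2)`. -/
theorem coe_le_seqRegret (hn : 1 ≤ n) {Θ : Set (EuclideanSpace ℝ (Fin d))}
    (hΘ : IsCompact Θ) (hpos : 0 < volume Θ) :
    (((d : ℝ) / 2 * Real.log (n / (2 * Real.pi)) + Real.log (volume Θ).toReal : ℝ) : EReal) ≤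
      seqRegret gaussDensity Θ volume n := by
  have hn0 : (0 : ℝ) < n := by exact_mod_cast hn
  have hfin : volume Θ ≠ ⊤ := hΘ.measure_lt_top.ne
  set V := (volume Θ).toReal with hV
  have hVpos : 0 < V := ENNReal.toReal_pos hpos.ne' hfin
  refine le_iInf₂ fun q hq => ?_
  obtain ⟨hqm, hq0, hq1⟩ := hq
  rw [← volume_pi] at hq1
  -- Testing against real `w` strictly above the worst regret makes the case of infinite regret
  -- vacuous.
  refine EReal.le_of_forall_lt_iff_le.1 fun w hw => ?_
  have hpt : ∀ y : Fin n → EuclideanSpace ℝ (Fin d), sampleMean y ∈ Θ →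
      (2 * Real.pi) ^ (-((n : ℝ) * d) / 2) * Real.exp (-(1 / 2) * scatter y) ≤
        Real.exp w * q y := by
    intro y hy
    have h1 : regretAt gaussDensity q (sampleMean y) y < w :=
      lt_of_le_of_lt (le_iSup_of_le y
        (le_iSup₂_of_le (f := fun θ (_ : θ ∈ Θ) => regretAt gaussDensity q θ y) _ hy le_rfl)) hw
    have hf : 0 < ∏ t, gaussDensity (sampleMean y) (y t) :=
      Finset.prod_pos fun t _ => gaussDensity_pos _ _
    have hqy : 0 < q y := by
      refine lt_of_le_of_ne (hq0 y) fun h0 => ?_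
      rw [regretAt, logRatio, if_pos h0.symm, if_neg hf.ne'] at h1
      exact not_top_lt h1
    rw [regretAt, logRatio_of_pos hf hqy, EReal.coe_lt_coe_iff] at h1
    have h2 := prod_gaussDensity hn (sampleMean y) y
    simp only [sub_self, norm_zero, ne_eq, OfNat.ofNat_ne_zero, not_false_eq_true, zero_pow,
      mul_zero, add_zero] at h2
    rw [← h2, ← Real.log_le_log_iff hf (by positivity),
      Real.log_mul (Real.exp_pos _).ne' hqy.ne', Real.log_exp]
    linarith
  have h3 : ∫⁻ y : Fin n → EuclideanSpace ℝ (Fin d),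
      ENNReal.ofReal ((2 * Real.pi) ^ (-((n : ℝ) * d) / 2)) *
        (ENNReal.ofReal (Real.exp (-(1 / 2) * scatter y)) *
          Θ.indicator (fun _ => 1) (sampleMean y)) ≤ ENNReal.ofReal (Real.exp w) := by
    calc _ ≤ ∫⁻ y : Fin n → EuclideanSpace ℝ (Fin d),
          ENNReal.ofReal (Real.exp w) * ENNReal.ofReal (q y) := by
          refine lintegral_mono fun y => ?_
          by_cases hy : sampleMean y ∈ Θ
          · rw [Set.indicator_of_mem hy, mul_one, ← ENNReal.ofReal_mul (by positivity),
              ← ENNReal.ofReal_mul (by positivity)]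
            exact ENNReal.ofReal_le_ofReal (hpt y hy)
          · simp [Set.indicator_of_notMem hy]
      _ = _ := by rw [lintegral_const_mul' _ _ ENNReal.ofReal_ne_top, hq1, mul_one]
  rw [lintegral_const_mul' _ _ ENNReal.ofReal_ne_top,
    lintegral_exp_scatter_mul hn one_pos (measurable_const.indicator hΘ.measurableSet),
    lintegral_indicator hΘ.measurableSet, setLIntegral_const, one_mul,
    ← ENNReal.ofReal_toReal hfin, ← hV, ← ENNReal.ofReal_mul (by positivity),
    ← ENNReal.ofReal_mul (by positivity), ENNReal.ofReal_le_ofReal_iff (Real.exp_pos _).le] at h3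
  rw [EReal.coe_le_coe_iff, ← Real.exp_le_exp]
  refine le_trans (le_of_eq ?_) h3
  rw [Real.exp_add, Real.exp_log hVpos, mul_comm _ (Real.log _),
    ← Real.rpow_def_of_pos (by positivity), ← mul_assoc, div_one, mul_left_comm,
    ← Real.rpow_add (by positivity),
    show -((n : ℝ) * d) / 2 + (n - 1) * d / 2 = -((d : ℝ) / 2) by ring,
    Real.div_rpow hn0.le (by positivity), Real.rpow_neg (by positivity), ← div_eq_mul_inv]

end

/-! ### Explicit integrals: Laplace tail, Gaussian tubes and normalizers. -/

section

variable {d n : ℕ}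

theorem integrable_exp_scatter_mul (hn : 1 ≤ n) {s : ℝ} (hs : 0 < s)
    {ψ : EuclideanSpace ℝ (Fin d) → ℝ} (hψm : Measurable ψ) (hψ : Integrable ψ)
    (hψ0 : ∀ x, 0 ≤ ψ x) :
    Integrable fun y : Fin n → EuclideanSpace ℝ (Fin d) =>
      Real.exp (-(s / 2) * scatter y) * ψ (sampleMean y) := by
  have hm : Measurable fun y : Fin n → EuclideanSpace ℝ (Fin d) =>
      Real.exp (-(s / 2) * scatter y) * ψ (sampleMean y) := by
    have h1 := measurable_scatter (d := d) (n := n)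
    exact (Measurable.exp (by fun_prop)).mul (hψm.comp measurable_sampleMean)
  refine ⟨hm.aestronglyMeasurable, ?_⟩
  rw [hasFiniteIntegral_iff_ofReal
    (ae_of_all _ fun y => mul_nonneg (Real.exp_pos _).le (hψ0 _))]
  simp_rw [ENNReal.ofReal_mul (Real.exp_pos _).le]
  rw [lintegral_exp_scatter_mul hn hs (φ := fun x => ENNReal.ofReal (ψ x)) hψm.ennreal_ofReal]
  exact ENNReal.mul_lt_top ENNReal.ofReal_lt_top hψ.lintegral_lt_top

theorem integral_exp_scatter_mul (hn : 1 ≤ n) {s : ℝ} (hs : 0 < s)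
    {ψ : EuclideanSpace ℝ (Fin d) → ℝ} (hψm : Measurable ψ) (hψ : Integrable ψ)
    (hψ0 : ∀ x, 0 ≤ ψ x) :
    ∫ y : Fin n → EuclideanSpace ℝ (Fin d),
        Real.exp (-(s / 2) * scatter y) * ψ (sampleMean y) =
      (n : ℝ) ^ ((d : ℝ) / 2) * (2 * Real.pi / s) ^ (((n : ℝ) - 1) * d / 2) * ∫ x, ψ x := by
  rw [integral_eq_lintegral_of_nonneg_ae
    (ae_of_all _ fun y => mul_nonneg (Real.exp_pos _).le (hψ0 _))
    (integrable_exp_scatter_mul hn hs hψm hψ hψ0).aestronglyMeasurable]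
  simp_rw [ENNReal.ofReal_mul (Real.exp_pos _).le]
  rw [lintegral_exp_scatter_mul hn hs (φ := fun x => ENNReal.ofReal (ψ x)) hψm.ennreal_ofReal,
    ENNReal.toReal_mul, ENNReal.toReal_ofReal (by positivity),
    integral_eq_lintegral_of_nonneg_ae (ae_of_all _ hψ0) hψ.aestronglyMeasurable]

section LaplaceTail

theorem integral_exp_neg_mul_abs {α : ℝ} (hα : 0 < α) :
    ∫ x : ℝ, Real.exp (-α * |x|) = 2 / α := by
  rw [integral_comp_abs (f := fun x => Real.exp (-α * x)),
    integral_exp_mul_Ioi (neg_lt_zero.2 hα)]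
  simp
  ring

theorem lintegral_exp_neg_mul_sum_abs {α : ℝ} (hα : 0 < α) :
    ∫⁻ x : EuclideanSpace ℝ (Fin d), ENNReal.ofReal (Real.exp (-α * ∑ j, |x j|)) =
      ENNReal.ofReal ((2 / α) ^ d) := by
  have hint : Integrable fun x : ℝ => Real.exp (-α * |x|) :=
    .of_integral_ne_zero (by rw [integral_exp_neg_mul_abs hα]; positivity)
  have h := lintegral_ofReal_prod (n := d) (volume : Measure ℝ)
    (fun _ x => Real.exp (-α * |x|)) (fun _ => hint) fun _ x => (Real.exp_pos _).le
  simp only [← Real.exp_sum, ← Finset.mul_sum, ← volume_pi] at h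
  rw [integral_exp_neg_mul_abs hα, Finset.prod_const, Finset.card_univ, Fintype.card_fin,
    ← ENNReal.ofReal_pow (by positivity)] at h
  rw [← h]
  refine (PiLp.volume_preserving_ofLp (Fin d)).lintegral_comp
    (f := fun x : Fin d → ℝ => ENNReal.ofReal (Real.exp (-α * ∑ j, |x j|))) ?_
  exact (Continuous.measurable (by fun_prop)).ennreal_ofReal

theorem laplaceTail_pos {α : ℝ} (hα : 0 < α) (hn : 1 ≤ n)
    (y : Fin n → EuclideanSpace ℝ (Fin d)) : 0 < laplaceTail α n y := by
  have hn0 : (0 : ℝ) < n := by exact_mod_cast hn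
  unfold laplaceTail
  positivity

theorem measurable_laplaceTail (α : ℝ) :
    Measurable (laplaceTail α n : (Fin n → EuclideanSpace ℝ (Fin d)) → ℝ) := by
  unfold laplaceTail
  have := continuous_sampleMean (d := d) (n := n)
  exact Continuous.measurable (by fun_prop)

theorem lintegral_laplaceTail {α : ℝ} (hα : 0 < α) (hn : 1 ≤ n) :
    ∫⁻ y : Fin n → EuclideanSpace ℝ (Fin d), ENNReal.ofReal (laplaceTail α n y) = 1 := by
  have hn0 : (0 : ℝ) < n := by exact_mod_cast hn
  have hφ : Measurable fun x : EuclideanSpace ℝ (Fin d) =>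
      ENNReal.ofReal (Real.exp (-α * ∑ j, |x j|)) :=
    (Continuous.measurable (by fun_prop)).ennreal_ofReal
  have h1 : ∀ y : Fin n → EuclideanSpace ℝ (Fin d), ENNReal.ofReal (laplaceTail α n y) =
      ENNReal.ofReal ((2 * Real.pi) ^ (-(((n : ℝ) - 1) * d) / 2) * (α / (2 * Real.sqrt n)) ^ d) *
        (ENNReal.ofReal (Real.exp (-(1 / 2) * scatter y)) *
          ENNReal.ofReal (Real.exp (-α * ∑ j, |sampleMean y j|))) := by
    intro y
    rw [← ENNReal.ofReal_mul (by positivity), ← ENNReal.ofReal_mul (by positivity), laplaceTail,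
      scatter]
    congr 1
    ring
  simp_rw [h1]
  rw [lintegral_const_mul' _ _ ENNReal.ofReal_ne_top, lintegral_exp_scatter_mul hn one_pos hφ,
    lintegral_exp_neg_mul_sum_abs hα, ← ENNReal.ofReal_mul (by positivity),
    ← ENNReal.ofReal_mul (by positivity), ← ENNReal.ofReal_one]
  congr 1
  have h2 : (n : ℝ) ^ ((d : ℝ) / 2) = Real.sqrt n ^ d := by
    rw [Real.sqrt_eq_rpow, ← Real.rpow_mul_natCast hn0.le]
    congr 1
    ring
  have h3 : (2 * Real.pi) ^ (-(((n : ℝ) - 1) * d) / 2) *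
      (2 * Real.pi / 1) ^ (((n : ℝ) - 1) * d / 2) = 1 := by
    rw [div_one, ← Real.rpow_add (by positivity), neg_div, neg_add_cancel, Real.rpow_zero]
  have h4 : (α / (2 * Real.sqrt n)) ^ d * (Real.sqrt n ^ d * (2 / α) ^ d) = 1 := by
    rw [← mul_pow, ← mul_pow]
    have : Real.sqrt n ≠ 0 := (Real.sqrt_pos.2 hn0).ne'
    rw [show α / (2 * Real.sqrt n) * (Real.sqrt n * (2 / α)) = 1 by field_simp, one_pow]
  rw [h2]
  linear_combination ((α / (2 * Real.sqrt n)) ^ d * (Real.sqrt n ^ d * (2 / α) ^ d)) * h3 + h4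

end LaplaceTail

section Tube

variable {K : Set (EuclideanSpace ℝ (Fin d))}

/-- If `K` lies in the ball of radius `M`, then `‖x‖ ≤ dist(x, K) + M`, hence `‖x‖²/2 ≤ dist(x, K)²
+ M²`, and a centred Gaussian dominates. -/
theorem integrable_exp_neg_mul_sq_infDist (hK : Bornology.IsBounded K) (hne : K.Nonempty) {b : ℝ}
    (hb : 0 < b) : Integrable fun x => Real.exp (-b * Metric.infDist x K ^ 2) := by
  obtain ⟨M, hM⟩ := hK.subset_closedBall 0
  have hdom := (integrable_exp_neg_mul_sq_norm (d := d) (half_pos hb)).const_mul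
    (Real.exp (b * M ^ 2))
  refine hdom.mono' ?_ (ae_of_all _ fun x => ?_)
  · have := Metric.continuous_infDist_pt K
    exact (Continuous.measurable (by fun_prop)).aestronglyMeasurable
  · rw [Real.norm_of_nonneg (Real.exp_pos _).le, ← Real.exp_add, Real.exp_le_exp]
    have h1 : ‖x‖ - M ≤ Metric.infDist x K := by
      refine (Metric.le_infDist hne).2 fun y hy => ?_
      have h2 : ‖y‖ ≤ M := by simpa using hM hy
      have h3 := norm_sub_norm_le x y
      rw [dist_eq_norm]
      linarith
    have h0 : 0 ≤ Metric.infDist x K := Metric.infDist_nonneg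
    have h4 : ‖x‖ ^ 2 / 2 ≤ M ^ 2 + Metric.infDist x K ^ 2 := by
      have h5 : ‖x‖ ^ 2 ≤ (Metric.infDist x K + M) ^ 2 :=
        pow_le_pow_left₀ (norm_nonneg x) (by linarith) 2
      nlinarith [sq_nonneg (Metric.infDist x K - M)]
    nlinarith

theorem volume_real_le_integral_exp_infDist (hK : IsCompact K) (hne : K.Nonempty) {b : ℝ}
    (hb : 0 < b) {Θ : Set (EuclideanSpace ℝ (Fin d))} (hΘ : MeasurableSet Θ) (hsub : Θ ⊆ K) :
    (volume Θ).toReal ≤ ∫ x, Real.exp (-b * Metric.infDist x K ^ 2) := by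
  have hint := integrable_exp_neg_mul_sq_infDist hK.isBounded hne hb
  have hfin : volume Θ ≠ ⊤ := (hK.isBounded.subset hsub).measure_lt_top.ne
  have h1 : (volume Θ).toReal = ∫ x, Θ.indicator (fun _ => (1 : ℝ)) x := by
    rw [integral_indicator hΘ]
    simp [Measure.real]
  rw [h1]
  refine integral_mono ((integrable_indicator_iff hΘ).2 (integrableOn_const hfin)) hint fun x => ?_
  by_cases hx : x ∈ Θ
  · simp [Set.indicator_of_mem hx, Metric.infDist_zero_of_mem (hsub hx)]
  · rw [Set.indicator_of_notMem hx]
    exact (Real.exp_pos _).le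

theorem infDist_sub_le_infDist_cthickening (hK : IsCompact K) (hne : K.Nonempty) {τ : ℝ}
    (hτ : 0 ≤ τ) (x : EuclideanSpace ℝ (Fin d)) :
    Metric.infDist x K - τ ≤ Metric.infDist x (Metric.cthickening τ K) := by
  refine (Metric.le_infDist (hne.mono (Metric.self_subset_cthickening K))).2 fun z hz => ?_
  rw [hK.cthickening_eq_biUnion_closedBall hτ] at hz
  simp only [Set.mem_iUnion, Metric.mem_closedBall] at hz
  obtain ⟨w, hw, hzw⟩ := hz
  have h1 := Metric.infDist_le_dist_of_mem (x := x) hw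
  have h2 := dist_triangle x z w
  linarith

/-- The integrand equals one on `K`. Off `K` the distance to the shrinking tube eventually exceeds
half the distance to `K`, so the factor `n` kills it. The dominating function is the integrand with
`n = 1` and `τ = 1`. -/
theorem tendsto_integral_exp_infDist (hK : IsCompact K) (hne : K.Nonempty) {τ : ℕ → ℝ}
    (hτ0 : ∀ n, 0 ≤ τ n) (hτ : Tendsto τ atTop (𝓝 0)) :
    Tendsto (fun n : ℕ => ∫ x, Real.exp (-((n : ℝ) / 2) *
      Metric.infDist x (Metric.cthickening (τ n) K) ^ 2)) atTop (𝓝 (volume K).toReal) := by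
  have h1 : (volume K).toReal = ∫ x, K.indicator (fun _ => (1 : ℝ)) x := by
    rw [integral_indicator hK.measurableSet]
    simp [Measure.real]
  rw [h1]
  refine tendsto_integral_filter_of_dominated_convergence
    (fun x => Real.exp (-(1 / 2) * Metric.infDist x (Metric.cthickening 1 K) ^ 2)) ?_ ?_ ?_ ?_
  · refine Eventually.of_forall fun n => ?_
    have := Metric.continuous_infDist_pt (Metric.cthickening (τ n) K)
    exact (Continuous.measurable (by fun_prop)).aestronglyMeasurable
  · filter_upwards [eventually_ge_atTop 1, hτ.eventually_lt_const one_pos] with n hn hn1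
    refine ae_of_all _ fun x => ?_
    rw [Real.norm_of_nonneg (Real.exp_pos _).le, Real.exp_le_exp]
    have h2 : Metric.infDist x (Metric.cthickening 1 K) ≤
        Metric.infDist x (Metric.cthickening (τ n) K) :=
      Metric.infDist_le_infDist_of_subset (Metric.cthickening_mono hn1.le K)
        (hne.mono (Metric.self_subset_cthickening K))
    have h3 : Metric.infDist x (Metric.cthickening 1 K) ^ 2 ≤
        Metric.infDist x (Metric.cthickening (τ n) K) ^ 2 :=
      pow_le_pow_left₀ Metric.infDist_nonneg h2 2
    have h4 : (1 : ℝ) ≤ n := by exact_mod_cast hn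
    nlinarith [sq_nonneg (Metric.infDist x (Metric.cthickening (τ n) K))]
  · exact integrable_exp_neg_mul_sq_infDist hK.isBounded.cthickening
      (hne.mono (Metric.self_subset_cthickening K)) (by norm_num)
  · refine ae_of_all _ fun x => ?_
    by_cases hx : x ∈ K
    · rw [Set.indicator_of_mem hx]
      refine tendsto_const_nhds.congr fun n => ?_
      simp [Metric.infDist_zero_of_mem (Metric.self_subset_cthickening K hx)]
    · rw [Set.indicator_of_notMem hx]
      set δ := Metric.infDist x K with hδ
      have hδpos : 0 < δ := (hK.isClosed.notMem_iff_infDist_pos hne).1 hx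
      refine Real.tendsto_exp_atBot.comp ?_
      have h5 : Tendsto (fun n : ℕ => -((n : ℝ) * (δ ^ 2 / 8))) atTop atBot :=
        tendsto_neg_atTop_atBot.comp
          (tendsto_natCast_atTop_atTop.atTop_mul_const (by positivity))
      refine tendsto_atBot_mono' _ ?_ h5
      filter_upwards [hτ.eventually_lt_const (half_pos hδpos)] with n hn
      have h6 := infDist_sub_le_infDist_cthickening hK hne (hτ0 n) x
      have h7 : (δ / 2) ^ 2 ≤ Metric.infDist x (Metric.cthickening (τ n) K) ^ 2 :=
        pow_le_pow_left₀ (by positivity) (by linarith) 2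
      have h8 : (0 : ℝ) ≤ n := Nat.cast_nonneg n
      nlinarith

end Tube

section MaxLikelihood

variable {Θ : Set (EuclideanSpace ℝ (Fin d))}

/-- Splitting the squares about the sample mean leaves only `‖ȳ - θ‖` to minimize, and compactness
of the tube provides a nearest point. -/
theorem maxLikelihood_eq (hn : 1 ≤ n) (hΘ : IsCompact Θ) (hne : Θ.Nonempty) {v τ : ℝ}
    (hv : 0 < v) (y : Fin n → EuclideanSpace ℝ (Fin d)) :
    maxLikelihood Θ v τ y = (2 * Real.pi * v) ^ (-((n : ℝ) * d) / 2) *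
      (Real.exp (-(1 / v / 2) * scatter y) *
        Real.exp (-(n / (2 * v)) *
          Metric.infDist (sampleMean y) (Metric.cthickening τ Θ) ^ 2)) := by
  have hcne : (Metric.cthickening τ Θ).Nonempty := hne.mono (Metric.self_subset_cthickening Θ)
  have hcc : IsCompact (Metric.cthickening τ Θ) := hΘ.cthickening
  have : Nonempty (Metric.cthickening τ Θ) := hcne.to_subtype
  have hterm : ∀ θ : EuclideanSpace ℝ (Fin d),
      (2 * Real.pi * v) ^ (-((n : ℝ) * d) / 2) *
        Real.exp (-(1 / (2 * v)) * ∑ t, ‖y t - θ‖ ^ 2) =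
      (2 * Real.pi * v) ^ (-((n : ℝ) * d) / 2) *
      (Real.exp (-(1 / v / 2) * scatter y) *
        Real.exp (-(n / (2 * v)) * dist (sampleMean y) θ ^ 2)) := by
    intro θ
    rw [sum_sq_norm_sub hn, ← Real.exp_add, dist_eq_norm]
    congr 2
    field_simp
    ring
  have hle : ∀ θ : Metric.cthickening τ Θ,
      (2 * Real.pi * v) ^ (-((n : ℝ) * d) / 2) *
        Real.exp (-(1 / (2 * v)) * ∑ t, ‖y t - (θ : EuclideanSpace ℝ (Fin d))‖ ^ 2) ≤
      (2 * Real.pi * v) ^ (-((n : ℝ) * d) / 2) *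
      (Real.exp (-(1 / v / 2) * scatter y) *
        Real.exp (-(n / (2 * v)) *
          Metric.infDist (sampleMean y) (Metric.cthickening τ Θ) ^ 2)) := by
    intro θ
    rw [hterm]
    have h1 := Metric.infDist_le_dist_of_mem (x := sampleMean y) θ.2
    have h2 : Metric.infDist (sampleMean y) (Metric.cthickening τ Θ) ^ 2 ≤
        dist (sampleMean y) (θ : EuclideanSpace ℝ (Fin d)) ^ 2 :=
      pow_le_pow_left₀ Metric.infDist_nonneg h1 2
    have h3 : (0 : ℝ) ≤ n / (2 * v) := by positivity
    gcongr ?_ * (?_ * Real.exp ?_)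
    simp only [neg_mul, neg_le_neg_iff]
    gcongr
  unfold maxLikelihood
  refine le_antisymm (ciSup_le hle) ?_
  obtain ⟨θ, hθ, hdist⟩ := hcc.exists_infDist_eq_dist hcne (sampleMean y)
  rw [hdist, ← hterm]
  exact le_ciSup (f := fun θ : Metric.cthickening τ Θ => (2 * Real.pi * v) ^ (-((n : ℝ) * d) / 2) *
        Real.exp (-(1 / (2 * v)) * ∑ t, ‖y t - (θ : EuclideanSpace ℝ (Fin d))‖ ^ 2))
    ⟨_, Set.forall_mem_range.2 hle⟩ ⟨θ, hθ⟩

theorem maxLikelihood_pos (hn : 1 ≤ n) (hΘ : IsCompact Θ) (hne : Θ.Nonempty) {v τ : ℝ}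
    (hv : 0 < v) (y : Fin n → EuclideanSpace ℝ (Fin d)) : 0 < maxLikelihood Θ v τ y := by
  rw [maxLikelihood_eq hn hΘ hne hv]
  positivity

theorem measurable_maxLikelihood (hn : 1 ≤ n) (hΘ : IsCompact Θ) (hne : Θ.Nonempty) {v τ : ℝ}
    (hv : 0 < v) :
    Measurable (maxLikelihood Θ v τ : (Fin n → EuclideanSpace ℝ (Fin d)) → ℝ) := by
  have h := funext fun y : Fin n → EuclideanSpace ℝ (Fin d) =>
    maxLikelihood_eq (τ := τ) hn hΘ hne hv y
  change maxLikelihood Θ v τ = _ at h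
  rw [h]
  have h1 := continuous_scatter (d := d) (n := n)
  have h2 := continuous_sampleMean (d := d) (n := n)
  have h3 := (Metric.continuous_infDist_pt (Metric.cthickening τ Θ)).comp h2
  simp only [Function.comp_def] at h3
  exact Continuous.measurable (by fun_prop)

theorem measurable_exp_neg_mul_sq_infDist (b : ℝ) (K : Set (EuclideanSpace ℝ (Fin d))) :
    Measurable fun x => Real.exp (-b * Metric.infDist x K ^ 2) := by
  have := Metric.continuous_infDist_pt K
  exact Continuous.measurable (by fun_prop)

theorem integrable_maxLikelihood (hn : 1 ≤ n) (hΘ : IsCompact Θ) (hne : Θ.Nonempty) {v τ : ℝ}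
    (hv : 0 < v) :
    Integrable (maxLikelihood Θ v τ : (Fin n → EuclideanSpace ℝ (Fin d)) → ℝ) := by
  have h := funext fun y : Fin n → EuclideanSpace ℝ (Fin d) =>
    maxLikelihood_eq (τ := τ) hn hΘ hne hv y
  change maxLikelihood Θ v τ = _ at h
  rw [h]
  have hn0 : (0 : ℝ) < n := by exact_mod_cast hn
  exact (integrable_exp_scatter_mul hn (one_div_pos.2 hv)
    (ψ := fun x => Real.exp (-(n / (2 * v)) * Metric.infDist x (Metric.cthickening τ Θ) ^ 2))
    (measurable_exp_neg_mul_sq_infDist _ _)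
    (integrable_exp_neg_mul_sq_infDist hΘ.isBounded.cthickening
      (hne.mono (Metric.self_subset_cthickening Θ)) (by positivity))
    fun x => (Real.exp_pos _).le).const_mul _

/-- The scatter lives in `(n-1)d` dimensions, so its integral cancels all of `(2πv)^(-nd/2)` except
the power `-d/2`. -/
theorem integral_maxLikelihood (hn : 1 ≤ n) (hΘ : IsCompact Θ) (hne : Θ.Nonempty) {v τ : ℝ}
    (hv : 0 < v) :
    ∫ y : Fin n → EuclideanSpace ℝ (Fin d), maxLikelihood Θ v τ y =
      (n / (2 * Real.pi * v)) ^ ((d : ℝ) / 2) *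
        ∫ x, Real.exp (-(n / (2 * v)) * Metric.infDist x (Metric.cthickening τ Θ) ^ 2) := by
  have hn0 : (0 : ℝ) < n := by exact_mod_cast hn
  simp_rw [maxLikelihood_eq (τ := τ) hn hΘ hne hv]
  rw [integral_const_mul, integral_exp_scatter_mul hn (one_div_pos.2 hv)
    (ψ := fun x => Real.exp (-(n / (2 * v)) * Metric.infDist x (Metric.cthickening τ Θ) ^ 2))
    (measurable_exp_neg_mul_sq_infDist _ _)
    (integrable_exp_neg_mul_sq_infDist hΘ.isBounded.cthickening
      (hne.mono (Metric.self_subset_cthickening Θ)) (by positivity))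
    fun x => (Real.exp_pos _).le, ← mul_assoc]
  congr 1
  rw [div_div_eq_mul_div, div_one, mul_left_comm, ← Real.rpow_add (by positivity),
    show -((n : ℝ) * d) / 2 + (n - 1) * d / 2 = -((d : ℝ) / 2) by ring,
    Real.div_rpow hn0.le (by positivity), Real.rpow_neg (by positivity), ← div_eq_mul_inv]

end MaxLikelihood

end

section

variable {d n : ℕ}

/-! ### Mixtures of a normalized function with the Laplace tail. -/

section Mixture

theorem integral_pos_of_pos {g : (Fin n → EuclideanSpace ℝ (Fin d)) → ℝ} (hg : Integrable g)
    (hpos : ∀ y, 0 < g y) : 0 < ∫ y, g y := by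
  rw [integral_pos_iff_support_of_nonneg (fun y => (hpos y).le) hg]
  have : Function.support g = Set.univ := Set.eq_univ_of_forall fun y => (hpos y).ne'
  rw [this]
  exact NeZero.pos _

theorem isDensity_mixture (hn : 1 ≤ n) {g : (Fin n → EuclideanSpace ℝ (Fin d)) → ℝ}
    (hgm : Measurable g) (hg : Integrable g) (hpos : ∀ y, 0 < g y) {α lam : ℝ} (hα : 0 < α)
    (h0 : 0 < lam) (h1 : lam < 1) :
    IsDensity volume n (mixture lam (normalized g) (laplaceTail α n)) := by
  have hZ := integral_pos_of_pos hg hpos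
  have hn0 : ∀ y, 0 ≤ normalized g y := fun y => div_nonneg (hpos y).le hZ.le
  have hnm : Measurable (normalized g) := hgm.div_const _
  have hl0 : ∀ y : Fin n → EuclideanSpace ℝ (Fin d), 0 ≤ laplaceTail α n y :=
    fun y => (laplaceTail_pos hα hn y).le
  have hlm := measurable_laplaceTail (d := d) (n := n) α
  refine ⟨(hnm.const_mul _).add (hlm.const_mul _), fun y => ?_, ?_⟩
  · exact add_nonneg (mul_nonneg (by linarith) (hn0 y)) (mul_nonneg h0.le (hl0 y))
  · rw [← volume_pi]
    have h2 : ∀ y, ENNReal.ofReal (mixture lam (normalized g) (laplaceTail α n) y) =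
        ENNReal.ofReal (1 - lam) * ENNReal.ofReal (normalized g y) +
        ENNReal.ofReal lam * ENNReal.ofReal (laplaceTail α n y) := by
      intro y
      rw [mixture, ENNReal.ofReal_add (mul_nonneg (by linarith) (hn0 y))
        (mul_nonneg h0.le (hl0 y)), ENNReal.ofReal_mul (by linarith), ENNReal.ofReal_mul h0.le]
    have h3 : ∫⁻ y, ENNReal.ofReal (normalized g y) = 1 := by
      have h4 : Integrable (normalized g) := hg.div_const _
      rw [← ofReal_integral_eq_lintegral_ofReal h4 (ae_of_all _ hn0)]
      simp only [normalized]
      rw [integral_div, div_self hZ.ne', ENNReal.ofReal_one]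
    simp_rw [h2]
    rw [lintegral_add_left (hnm.ennreal_ofReal.const_mul _),
      lintegral_const_mul' _ _ ENNReal.ofReal_ne_top,
      lintegral_const_mul' _ _ ENNReal.ofReal_ne_top, h3, lintegral_laplaceTail hα hn, mul_one,
      mul_one, ← ENNReal.ofReal_add (by linarith) h0.le, sub_add_cancel, ENNReal.ofReal_one]

theorem mul_laplaceTail_le_mixture {g : (Fin n → EuclideanSpace ℝ (Fin d)) → ℝ}
    (hg : Integrable g) (hpos : ∀ y, 0 < g y) {α lam : ℝ} (h1 : lam < 1)
    (y : Fin n → EuclideanSpace ℝ (Fin d)) :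
    lam * laplaceTail α n y ≤ mixture lam (normalized g) (laplaceTail α n) y :=
  le_add_of_nonneg_left (mul_nonneg (by linarith)
    (div_nonneg (hpos y).le (integral_pos_of_pos hg hpos).le))

theorem mul_normalized_le_mixture (hn : 1 ≤ n) {g : (Fin n → EuclideanSpace ℝ (Fin d)) → ℝ}
    {α lam : ℝ} (hα : 0 < α) (h0 : 0 < lam) (y : Fin n → EuclideanSpace ℝ (Fin d)) :
    (1 - lam) * (g y / ∫ z, g z) ≤ mixture lam (normalized g) (laplaceTail α n) y :=
  le_add_of_nonneg_right (mul_nonneg h0.le (laplaceTail_pos hα hn y).le)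

end Mixture

/-! ### The normalizer of the two-variance maximum. -/

section TwoVariances

variable {Θ : Set (EuclideanSpace ℝ (Fin d))}

theorem integrable_max_maxLikelihood (hn : 1 ≤ n) (hΘ : IsCompact Θ) (hne : Θ.Nonempty) {v τ : ℝ}
    (hv : 0 < v) : Integrable fun y : Fin n → EuclideanSpace ℝ (Fin d) =>
      max (maxLikelihood Θ v τ y) (maxLikelihood Θ 1 τ y) :=
  (integrable_maxLikelihood hn hΘ hne hv).sup (integrable_maxLikelihood hn hΘ hne one_pos)

/-- The parabola `1 + η + (r - 1)²/(4η)` lies above `max r 1` and touches the line `r` at `r = 1 +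
2η`. A quadratic majorant is wanted because, for a ratio `r` of Gaussian weights, `G`, `rG` and
`r²G` all have explicit integrals. -/
theorem max_mul_le {G κ r x η : ℝ} (hG : 0 ≤ G) (hκ : 0 ≤ κ) (hη : 0 < η) (hx : x ≤ κ * (r * G)) :
    max x (κ * G) ≤ κ * ((1 + η + 1 / (4 * η)) * G - 1 / (2 * η) * (r * G) +
      1 / (4 * η) * (r ^ 2 * G)) := by
  have h1 : κ * ((1 + η + 1 / (4 * η)) * G - 1 / (2 * η) * (r * G) +
      1 / (4 * η) * (r ^ 2 * G)) = κ * G * (1 + η + (r - 1) ^ 2 / (4 * η)) := by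
    field_simp
    ring
  have h2 : r ≤ 1 + η + (r - 1) ^ 2 / (4 * η) := by
    have h3 : 1 + η + (r - 1) ^ 2 / (4 * η) - r = (r - 1 - 2 * η) ^ 2 / (4 * η) := by
      field_simp
      ring
    have h4 : 0 ≤ (r - 1 - 2 * η) ^ 2 / (4 * η) := by positivity
    linarith
  have h5 : 1 ≤ 1 + η + (r - 1) ^ 2 / (4 * η) := by
    have : 0 ≤ (r - 1) ^ 2 / (4 * η) := by positivity
    linarith
  rw [h1]
  refine max_le (hx.trans ?_) (le_mul_of_one_le_right (by positivity) h5)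
  rw [show κ * (r * G) = κ * G * r by ring]
  exact mul_le_mul_of_nonneg_left h2 (by positivity)

/-- Here `r` is the ratio of the two Gaussian weights in the scatter. The last fraction is the
normalized integral of `(r - 1)²`, a chi-square distance, divided by `4η`. -/
theorem integral_max_maxLikelihood_le (hn : 1 ≤ n) (hΘ : IsCompact Θ) (hne : Θ.Nonempty)
    {v τ η : ℝ} (hv : 0 < v) (hv1 : v ≤ 1) (hη : 0 < η) :
    ∫ y : Fin n → EuclideanSpace ℝ (Fin d),
        max (maxLikelihood Θ v τ y) (maxLikelihood Θ 1 τ y) ≤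
      (n / (2 * Real.pi)) ^ ((d : ℝ) / 2) *
        (∫ x, Real.exp (-((n : ℝ) / 2) * Metric.infDist x (Metric.cthickening τ Θ) ^ 2)) *
        (1 + η + (v ^ (-(d : ℝ)) * (v * (2 - v)) ^ (-(((n : ℝ) - 1) * d / 2)) -
          2 * v ^ (-((d : ℝ) / 2)) + 1) / (4 * η)) := by
  have hn0 : (0 : ℝ) < n := by exact_mod_cast hn
  set ψ : EuclideanSpace ℝ (Fin d) → ℝ := fun x =>
    Real.exp (-((n : ℝ) / 2) * Metric.infDist x (Metric.cthickening τ Θ) ^ 2) with hψ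
  have hψm : Measurable ψ := measurable_exp_neg_mul_sq_infDist _ _
  have hψi : Integrable ψ := integrable_exp_neg_mul_sq_infDist hΘ.isBounded.cthickening
      (hne.mono (Metric.self_subset_cthickening Θ)) (by positivity)
  have hψ0 : ∀ x, 0 ≤ ψ x := fun x => (Real.exp_pos _).le
  set κ : ℝ := (2 * Real.pi) ^ (-((n : ℝ) * d) / 2) with hκ
  have hκ0 : 0 ≤ κ := by positivity
  set c : ℝ := v ^ (-((n : ℝ) * d) / 2) with hc
  have hc0 : 0 ≤ c := by positivity
  -- The squared ratio times the unit-variance weight is a Gaussian weight of precision `2/v - 1`,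
  -- integrable only if this is positive.
  have hs2 : 0 < 2 / v - 1 := by
    have : 1 ≤ 1 / v := one_le_one_div hv hv1
    have h2 : 2 / v = 1 / v + 1 / v := by ring
    linarith
  have hs1 : 0 < 1 / v := one_div_pos.2 hv
  let E : ℝ → (Fin n → EuclideanSpace ℝ (Fin d)) → ℝ := fun s y =>
    Real.exp (-(s / 2) * scatter y) * ψ (sampleMean y)
  have hEi : ∀ s, 0 < s → Integrable (E s) := fun s hs =>
    integrable_exp_scatter_mul hn hs hψm hψi hψ0
  have hEint : ∀ s, 0 < s → ∫ y, E s y =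
      (n : ℝ) ^ ((d : ℝ) / 2) * (2 * Real.pi / s) ^ (((n : ℝ) - 1) * d / 2) * ∫ x, ψ x :=
    fun s hs => integral_exp_scatter_mul hn hs hψm hψi hψ0
  have hpt : ∀ y, max (maxLikelihood Θ v τ y) (maxLikelihood Θ 1 τ y) ≤
      κ * ((1 + η + 1 / (4 * η)) * E 1 y - 1 / (2 * η) * (c * E (1 / v) y) +
        1 / (4 * η) * (c ^ 2 * E (2 / v - 1) y)) := by
    intro y
    set r : ℝ := c * Real.exp (-((1 / v - 1) / 2) * scatter y) with hr
    have e1 : c * E (1 / v) y = r * E 1 y := by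
      simp only [E, hr]
      rw [show -(1 / v / 2) * scatter y = -((1 / v - 1) / 2) * scatter y + -(1 / 2) * scatter y
        by ring, Real.exp_add]
      ring
    have e2 : c ^ 2 * E (2 / v - 1) y = r ^ 2 * E 1 y := by
      simp only [E, hr]
      rw [show -((2 / v - 1) / 2) * scatter y = -((1 / v - 1) / 2) * scatter y +
        -((1 / v - 1) / 2) * scatter y + -(1 / 2) * scatter y by ring, Real.exp_add, Real.exp_add]
      ring
    have e3 : maxLikelihood Θ 1 τ y = κ * E 1 y := by
      rw [maxLikelihood_eq hn hΘ hne one_pos]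
      simp only [E, hψ, hκ, mul_one, div_one]
    -- Not an equality: the tube factor with rate `n/(2v)` is replaced by the larger one with rate
    -- `n/2`, so that all terms share the same `ψ`.
    have e4 : maxLikelihood Θ v τ y ≤ κ * (r * E 1 y) := by
      rw [maxLikelihood_eq hn hΘ hne hv, ← e1, Real.mul_rpow (by positivity) hv.le, mul_assoc]
      refine mul_le_mul_of_nonneg_left (mul_le_mul_of_nonneg_left
        (mul_le_mul_of_nonneg_left ?_ (Real.exp_pos _).le) hc0) hκ0
      simp only [hψ]
      rw [Real.exp_le_exp]
      have h1 : (n : ℝ) / 2 ≤ n / (2 * v) := by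
        refine div_le_div_of_nonneg_left hn0.le (by positivity) ?_
        linarith
      nlinarith [sq_nonneg (Metric.infDist (sampleMean y) (Metric.cthickening τ Θ))]
    rw [e1, e2, e3]
    exact max_mul_le (mul_nonneg (Real.exp_pos _).le (hψ0 _)) hκ0 hη e4
  have hi1 := (hEi 1 one_pos).const_mul (1 + η + 1 / (4 * η))
  have hi2 := ((hEi _ hs1).const_mul c).const_mul (1 / (2 * η))
  have hi3 := ((hEi _ hs2).const_mul (c ^ 2)).const_mul (1 / (4 * η))
  have hi12 : Integrable fun y => (1 + η + 1 / (4 * η)) * E 1 y - 1 / (2 * η) * (c * E (1 / v) y) :=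
    hi1.sub hi2
  have hi : Integrable fun y => κ * ((1 + η + 1 / (4 * η)) * E 1 y -
      1 / (2 * η) * (c * E (1 / v) y) + 1 / (4 * η) * (c ^ 2 * E (2 / v - 1) y)) :=
    (hi12.add hi3).const_mul κ
  refine (integral_mono (integrable_max_maxLikelihood hn hΘ hne hv) hi hpt).trans (le_of_eq ?_)
  rw [integral_const_mul, integral_add hi12 hi3, integral_sub hi1 hi2]
  simp only [integral_const_mul]
  rw [hEint 1 one_pos, hEint _ hs1, hEint _ hs2]
  set p : ℝ := ((n : ℝ) - 1) * d / 2 with hp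
  have hpi : (0 : ℝ) ≤ 2 * Real.pi := by positivity
  have k1 : κ * ((n : ℝ) ^ ((d : ℝ) / 2) * (2 * Real.pi) ^ p) =
      (n / (2 * Real.pi)) ^ ((d : ℝ) / 2) := by
    rw [mul_left_comm, ← Real.rpow_add (by positivity), hp,
      show -((n : ℝ) * d) / 2 + (n - 1) * d / 2 = -((d : ℝ) / 2) by ring,
      Real.div_rpow hn0.le (by positivity), Real.rpow_neg (by positivity), ← div_eq_mul_inv]
  have k2 : c * ((1 / v) ^ p)⁻¹ = v ^ (-((d : ℝ) / 2)) := by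
    rw [← Real.inv_rpow hs1.le, one_div, inv_inv, hc, ← Real.rpow_add hv, hp]
    congr 1
    ring
  have k3 : c ^ 2 * ((2 / v - 1) ^ p)⁻¹ =
      v ^ (-(d : ℝ)) * (v * (2 - v)) ^ (-p) := by
    rw [← Real.rpow_neg hs2.le, show 2 / v - 1 = (2 - v) / v by field_simp,
      Real.div_rpow (by linarith) hv.le, Real.mul_rpow hv.le (by linarith), div_eq_mul_inv,
      ← Real.rpow_neg hv.le, neg_neg, mul_comm ((2 - v) ^ (-p)), ← mul_assoc, ← mul_assoc, hc,
      ← Real.rpow_mul_natCast hv.le, ← Real.rpow_add hv, ← Real.rpow_add hv, hp]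
    congr 2
    push_cast
    ring
  rw [div_one, Real.div_rpow hpi hs1.le, Real.div_rpow hpi hs2.le, ← k1, ← k2, ← k3]
  field_simp
  ring

/-- Since `v(2 - v) = 1 - (1 - v)²`, the defect is at most `1/n²`, too small to matter in a power of
order `n`. -/
theorem tendsto_rpow_variance_defect {v : ℕ → ℝ}
    (hv : ∀ᶠ n : ℕ in atTop, 1 - 1 / (n : ℝ) ≤ v n ∧ v n ≤ 1) :
    Tendsto v atTop (𝓝 1) ∧
      Tendsto (fun n : ℕ => (v n * (2 - v n)) ^ (-(((n : ℝ) - 1) * d / 2))) atTop (𝓝 1) := by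
  have h0 : Tendsto (fun n : ℕ => 1 - 1 / (n : ℝ)) atTop (𝓝 1) := by
    simpa using (tendsto_one_div_atTop_nhds_zero_nat (𝕜 := ℝ)).const_sub 1
  refine ⟨tendsto_of_tendsto_of_tendsto_of_le_of_le' h0 tendsto_const_nhds
    (hv.mono fun _ h => h.1) (hv.mono fun _ h => h.2), ?_⟩
  have hub : Tendsto (fun n : ℕ => Real.exp ((d : ℝ) * (1 / (n : ℝ)))) atTop (𝓝 1) := by
    have h1 := (tendsto_one_div_atTop_nhds_zero_nat (𝕜 := ℝ)).const_mul (d : ℝ)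
    rw [mul_zero] at h1
    simpa [Function.comp_def] using (Real.continuous_exp.tendsto 0).comp h1
  refine tendsto_of_tendsto_of_tendsto_of_le_of_le' tendsto_const_nhds hub ?_ ?_
  · filter_upwards [hv, eventually_ge_atTop 2] with n h hn
    have hn2 : (2 : ℝ) ≤ n := by exact_mod_cast hn
    have h3 : 1 / (n : ℝ) ≤ 1 / 2 := one_div_le_one_div_of_le two_pos hn2
    have hpos : 0 < v n * (2 - v n) := mul_pos (by linarith) (by linarith)
    refine Real.one_le_rpow_of_pos_of_le_one_of_nonpos hpos ?_ ?_
    · nlinarith [sq_nonneg (v n - 1)]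
    · have : 0 ≤ ((n : ℝ) - 1) * d / 2 := by
        have : 0 ≤ (n : ℝ) - 1 := by linarith
        positivity
      linarith
  · filter_upwards [hv, eventually_ge_atTop 2] with n h hn
    have hn2 : (2 : ℝ) ≤ n := by exact_mod_cast hn
    have h3 : 1 / (n : ℝ) ≤ 1 / 2 := one_div_le_one_div_of_le two_pos hn2
    have hpos : 0 < v n * (2 - v n) := mul_pos (by linarith) (by linarith)
    rw [Real.rpow_def_of_pos hpos, Real.exp_le_exp]
    have h4 : (1 - v n) ^ 2 ≤ (1 / (n : ℝ)) ^ 2 :=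
      pow_le_pow_left₀ (by linarith) (by linarith) 2
    have h5 : 1 / 2 ≤ v n * (2 - v n) := by nlinarith
    have h6 : -(2 * (1 / (n : ℝ)) ^ 2) ≤ Real.log (v n * (2 - v n)) := by
      refine le_trans ?_ (Real.one_sub_inv_le_log_of_pos hpos)
      rw [neg_le_sub_iff_le_add, inv_le_iff_one_le_mul₀ hpos]
      nlinarith [sq_nonneg (1 / (n : ℝ))]
    have h7 : 0 ≤ ((n : ℝ) - 1) * d / 2 := by
      have : 0 ≤ (n : ℝ) - 1 := by linarith
      positivity
    have h8 : (1 / (n : ℝ)) ^ 2 * n = 1 / n := by field_simp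
    have h9 : (0 : ℝ) ≤ d := Nat.cast_nonneg d
    calc Real.log (v n * (2 - v n)) * -(((n : ℝ) - 1) * d / 2)
        = -Real.log (v n * (2 - v n)) * (((n : ℝ) - 1) * d / 2) := by ring
      _ ≤ 2 * (1 / (n : ℝ)) ^ 2 * (((n : ℝ) - 1) * d / 2) :=
          mul_le_mul_of_nonneg_right (by linarith) h7
      _ = d * ((1 / (n : ℝ)) ^ 2 * n - (1 / (n : ℝ)) ^ 2) := by ring
      _ ≤ d * (1 / (n : ℝ)) := by
          refine mul_le_mul_of_nonneg_left ?_ h9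
          rw [h8]
          linarith [sq_nonneg (1 / (n : ℝ))]

theorem eventually_integral_max_maxLikelihood_le (hΘ : IsCompact Θ) (hpos : 0 < volume Θ)
    {v τ : ℕ → ℝ} (hv : ∀ᶠ n : ℕ in atTop, 1 - 1 / (n : ℝ) ≤ v n ∧ v n ≤ 1)
    (hτ0 : ∀ n, 0 ≤ τ n) (hτ : Tendsto τ atTop (𝓝 0)) {δ : ℝ} (hδ : 0 < δ) :
    ∀ᶠ n : ℕ in atTop, Real.log (∫ y : Fin n → EuclideanSpace ℝ (Fin d),
        max (maxLikelihood Θ (v n) (τ n) y) (maxLikelihood Θ 1 (τ n) y)) ≤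
      (d : ℝ) / 2 * Real.log (n / (2 * Real.pi)) + Real.log (volume Θ).toReal + δ := by
  have hne : Θ.Nonempty := nonempty_of_measure_ne_zero hpos.ne'
  have hVpos : 0 < (volume Θ).toReal := ENNReal.toReal_pos hpos.ne' hΘ.measure_lt_top.ne
  obtain ⟨hv1, hdef⟩ := tendsto_rpow_variance_defect (d := d) hv
  have hp1 : Tendsto (fun n => v n ^ (-(d : ℝ))) atTop (𝓝 1) := by
    simpa using hv1.rpow_const (p := -(d : ℝ)) (Or.inl one_ne_zero)
  have hp2 : Tendsto (fun n => v n ^ (-((d : ℝ) / 2))) atTop (𝓝 1) := by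
    simpa using hv1.rpow_const (p := -((d : ℝ) / 2)) (Or.inl one_ne_zero)
  have hlim := (tendsto_integral_exp_infDist hΘ hne hτ0 hτ).mul
    (((((hp1.mul hdef).sub (hp2.const_mul 2)).add_const 1).div_const (4 * (δ / 2))).const_add (1 + δ / 2))
  -- The chi-square term vanishes in the limit, leaving `1 + δ/2 < exp δ`; this is the choice `η =
  -- δ/2`.
  have hlt : (volume Θ).toReal * (1 + δ / 2 + (1 * 1 - 2 * 1 + 1) / (4 * (δ / 2))) <
      (volume Θ).toReal * Real.exp δ := by
    refine mul_lt_mul_of_pos_left ?_ hVpos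
    have := Real.add_one_lt_exp hδ.ne'
    norm_num
    linarith
  filter_upwards [hlim.eventually_lt_const hlt, hv, eventually_ge_atTop 2] with n h1 h2 hn
  have hn1 : 1 ≤ n := by omega
  have hn2 : (2 : ℝ) ≤ n := by exact_mod_cast hn
  have h3 : 1 / (n : ℝ) ≤ 1 / 2 := one_div_le_one_div_of_le two_pos hn2
  have hv0 : 0 < v n := by linarith
  have hκ : 0 < ((n : ℝ) / (2 * Real.pi)) ^ ((d : ℝ) / 2) := by positivity
  have h4 := integral_max_maxLikelihood_le (τ := τ n) hn1 hΘ hne hv0 h2.2 (half_pos hδ)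
  rw [mul_assoc] at h4
  have h5 := h4.trans (mul_le_mul_of_nonneg_left h1.le hκ.le)
  have hZ : 0 < ∫ y : Fin n → EuclideanSpace ℝ (Fin d),
      max (maxLikelihood Θ (v n) (τ n) y) (maxLikelihood Θ 1 (τ n) y) :=
    integral_pos_of_pos (integrable_max_maxLikelihood hn1 hΘ hne hv0)
      fun y => lt_max_of_lt_left (maxLikelihood_pos hn1 hΘ hne hv0 y)
  refine (Real.log_le_log hZ h5).trans (le_of_eq ?_)
  rw [Real.log_mul hκ.ne' (by positivity), Real.log_mul hVpos.ne' (Real.exp_pos _).ne',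
    Real.log_exp, Real.log_rpow (by positivity)]
  ring

end TwoVariances

end

/-! ### Moment inequality for iid samples of arbitrary law. -/

section

variable {d n : ℕ}

/-- By Fubini, integrability holds in one observation for almost every choice of the others. With
these frozen, the sample mean is an affine function of the remaining observation. -/
theorem integrable_sq_norm_of_integrable_sq_norm_sampleMean (hn : 1 ≤ n)
    (P : Measure (EuclideanSpace ℝ (Fin d))) [IsProbabilityMeasure P]
    (θ : EuclideanSpace ℝ (Fin d))
    (h : Integrable (fun y => ‖sampleMean y - θ‖ ^ 2) (Measure.pi fun _ : Fin n => P)) :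
    Integrable (fun x => ‖x - θ‖ ^ 2) P := by
  obtain ⟨k, rfl⟩ : ∃ k, n = k + 1 := ⟨n - 1, by omega⟩
  have hmp := (measurePreserving_piFinSuccAbove
    (fun _ : Fin (k + 1) => P) 0).symm
  have h1 := (hmp.integrable_comp_emb (MeasurableEquiv.measurableEmbedding _)).2 h
  have h2 := h1.prod_left_ae
  obtain ⟨r, hr⟩ := h2.exists
  have hk : (0 : ℝ) < ((k + 1 : ℕ) : ℝ) := by positivity
  set c := ∑ t, r t with hc
  have h3 : Integrable (fun x => ‖((k + 1 : ℕ) : ℝ)⁻¹ • (x + c) - θ‖ ^ 2) P := by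
    refine hr.congr (ae_of_all _ fun x => ?_)
    simp [sampleMean, Fin.sum_univ_succ, hc]
  set w := c + θ - ((k + 1 : ℕ) : ℝ) • θ with hw
  have hdom := (h3.const_mul (2 * ((k + 1 : ℕ) : ℝ) ^ 2)).add (integrable_const (2 * ‖w‖ ^ 2))
  refine hdom.mono' (Continuous.aestronglyMeasurable (by fun_prop)) (ae_of_all _ fun x => ?_)
  rw [Real.norm_of_nonneg (by positivity)]
  have h4 : x - θ = ((k + 1 : ℕ) : ℝ) • (((k + 1 : ℕ) : ℝ)⁻¹ • (x + c) - θ) - w := by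
    rw [smul_sub, smul_smul, mul_inv_cancel₀ hk.ne', one_smul, hw]
    abel
  have h5 := norm_sub_le (((k + 1 : ℕ) : ℝ) • (((k + 1 : ℕ) : ℝ)⁻¹ • (x + c) - θ)) w
  rw [← h4, norm_smul, Real.norm_of_nonneg hk.le] at h5
  have h6 := pow_le_pow_left₀ (norm_nonneg _) h5 2
  simp only [Pi.add_apply]
  nlinarith [sq_nonneg (((k + 1 : ℕ) : ℝ) * ‖((k + 1 : ℕ) : ℝ)⁻¹ • (x + c) - θ‖ - ‖w‖)]

theorem memLp_coord_sub (P : Measure (EuclideanSpace ℝ (Fin d))) [IsProbabilityMeasure P]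
    (θ : EuclideanSpace ℝ (Fin d)) (h : Integrable (fun x => ‖x - θ‖ ^ 2) P) (j : Fin d) :
    MemLp (fun x => x j - θ j) 2 P := by
  have hc : Continuous fun x : EuclideanSpace ℝ (Fin d) => x j - θ j := by fun_prop
  refine (memLp_two_iff_integrable_sq hc.aestronglyMeasurable).2 ?_
  refine h.mono' (hc.pow 2).aestronglyMeasurable (ae_of_all _ fun x => ?_)
  rw [Real.norm_of_nonneg (by positivity), EuclideanSpace.norm_sq_eq]
  have := Finset.single_le_sum (f := fun i => ‖(x - θ) i‖ ^ 2) (fun i _ => by positivity)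
    (Finset.mem_univ j)
  simpa using this

/-- With `m` the mean of `f`, additivity of variance gives `E(∑ f)² = n E f² + n(n-1) m²`. -/
theorem mul_integral_sq_le_integral_sq_sum {Ω : Type*} [MeasurableSpace Ω] (P : Measure Ω)
    [IsProbabilityMeasure P] {f : Ω → ℝ} (hf : MemLp f 2 P) (hn : 1 ≤ n) :
    n * ∫ x, f x ^ 2 ∂P ≤ ∫ y, (∑ t, f (y t)) ^ 2 ∂(Measure.pi fun _ : Fin n => P) := by
  have hn1 : (1 : ℝ) ≤ n := by exact_mod_cast hn
  have hterm : ∀ t, MemLp (fun y : Fin n → Ω => f (y t)) 2 (Measure.pi fun _ : Fin n => P) :=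
    fun t => hf.comp_measurePreserving (measurePreserving_eval (fun _ : Fin n => P) t)
  have hsum : MemLp (fun y : Fin n → Ω => ∑ t, f (y t)) 2 (Measure.pi fun _ : Fin n => P) :=
    memLp_finsetSum _ fun t _ => hterm t
  have h1 := ProbabilityTheory.variance_sum_pi (μ := fun _ : Fin n => P)
    (X := fun _ : Fin n => f) fun _ => hf
  have h2 := ProbabilityTheory.variance_eq_sub hf
  have h3 := ProbabilityTheory.variance_eq_sub hsum
  have h4 : ∫ y, ∑ t, f (y t) ∂(Measure.pi fun _ : Fin n => P) = n * ∫ x, f x ∂P := by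
    rw [integral_finsetSum _ fun t _ => (hterm t).integrable (by norm_num)]
    have : ∀ t : Fin n, ∫ y, f (y t) ∂(Measure.pi fun _ : Fin n => P) = ∫ x, f x ∂P := fun t =>
      integral_comp_eval (μ := fun _ : Fin n => P) (i := t) hf.aestronglyMeasurable
    simp [this]
  have h5 : (∑ t : Fin n, fun y : Fin n → Ω => f (y t)) = fun y => ∑ t, f (y t) := by
    ext y
    simp
  simp only [Finset.sum_const, Finset.card_univ, Fintype.card_fin, nsmul_eq_mul] at h1
  rw [h5, h3, h2, h4] at h1
  simp only [Pi.pow_apply] at h1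
  nlinarith [sq_nonneg (∫ x, f x ∂P)]

/-- The one use of the iid structure that drives the robust bound: averaging cannot reduce the mean
squared distance to `θ` by more than a factor `n`. It follows coordinate by coordinate. -/
theorem integral_sq_norm_le_mul_integral_sampleMean (hn : 1 ≤ n)
    (P : Measure (EuclideanSpace ℝ (Fin d))) [IsProbabilityMeasure P]
    (θ : EuclideanSpace ℝ (Fin d)) (h : Integrable (fun x => ‖x - θ‖ ^ 2) P) :
    ∫ x, ‖x - θ‖ ^ 2 ∂P ≤
      n * ∫ y, ‖sampleMean y - θ‖ ^ 2 ∂(Measure.pi fun _ : Fin n => P) := by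
  have hn0 : (0 : ℝ) < n := by exact_mod_cast hn
  have hmem := memLp_coord_sub P θ h
  have hterm : ∀ j, Integrable (fun y : Fin n → EuclideanSpace ℝ (Fin d) =>
      (∑ t, (y t j - θ j)) ^ 2) (Measure.pi fun _ : Fin n => P) := fun j =>
    (memLp_finsetSum (f := fun t (y : Fin n → EuclideanSpace ℝ (Fin d)) => y t j - θ j) _
      fun t _ => (hmem j).comp_measurePreserving
        (measurePreserving_eval (fun _ : Fin n => P) t)).integrable_sq
  have h1 : ∀ x : EuclideanSpace ℝ (Fin d), ‖x - θ‖ ^ 2 = ∑ j, (x j - θ j) ^ 2 := by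
    intro x
    simp [EuclideanSpace.norm_sq_eq]
  have h2 : ∀ y : Fin n → EuclideanSpace ℝ (Fin d), ‖sampleMean y - θ‖ ^ 2 =
      ((n : ℝ) ^ 2)⁻¹ * ∑ j, (∑ t, (y t j - θ j)) ^ 2 := by
    intro y
    rw [h1, Finset.mul_sum]
    refine Finset.sum_congr rfl fun j _ => ?_
    have : (sampleMean y) j = (n : ℝ)⁻¹ * ∑ t, y t j := by simp [sampleMean]
    rw [this, Finset.sum_sub_distrib, Finset.sum_const, Finset.card_univ, Fintype.card_fin,
      nsmul_eq_mul]
    field_simp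
  simp_rw [h2, h1]
  rw [integral_const_mul, integral_finsetSum _ fun j _ => (hmem j).integrable_sq,
    integral_finsetSum _ fun j _ => hterm j]
  have h3 : ∀ j, ∫ x, (x j - θ j) ^ 2 ∂P ≤
      (n : ℝ)⁻¹ * ∫ y, (∑ t, (y t j - θ j)) ^ 2 ∂(Measure.pi fun _ : Fin n => P) := by
    intro j
    have := mul_integral_sq_le_integral_sq_sum P (hmem j) hn
    rw [le_inv_mul_iff₀ hn0]
    exact this
  refine (Finset.sum_le_sum fun j _ => h3 j).trans (le_of_eq ?_)
  rw [← Finset.mul_sum, ← mul_assoc]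
  congr 1
  field_simp

/-- A random variable below a scatter-quadratic form has expectation at most the constant term. -/
theorem expect_le_of_le_scatter (hn : 1 ≤ n) (P : Measure (EuclideanSpace ℝ (Fin d)))
    [IsProbabilityMeasure P] (θ : EuclideanSpace ℝ (Fin d))
    {X : (Fin n → EuclideanSpace ℝ (Fin d)) → EReal} {a b c C : ℝ} (ha : 0 ≤ a)
    (hab : a * n * (n - 1) ≤ 2 * b)
    (h1 : ∀ y, X y ≤ ((c + a / 2 * scatter y - b * ‖sampleMean y - θ‖ ^ 2 : ℝ) : EReal))
    (h2 : ∀ y, X y ≤ ((C - ‖sampleMean y - θ‖ ^ 2 / 4 : ℝ) : EReal)) :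
    expect (Measure.pi fun _ : Fin n => P) X ≤ c := by
  have hn0 : (0 : ℝ) < n := by exact_mod_cast hn
  have hcm := continuous_sampleMean (d := d) (n := n)
  have hcont : Continuous fun y : Fin n → EuclideanSpace ℝ (Fin d) =>
      ‖sampleMean y - θ‖ ^ 2 := by fun_prop
  by_cases hint : Integrable (fun y => ‖sampleMean y - θ‖ ^ 2) (Measure.pi fun _ : Fin n => P)
  · have hP := integrable_sq_norm_of_integrable_sq_norm_sampleMean hn P θ hint
    have hle := integral_sq_norm_le_mul_integral_sampleMean hn P θ hP
    have hterm : ∀ t : Fin n, Integrable (fun y : Fin n → EuclideanSpace ℝ (Fin d) =>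
        ‖y t - θ‖ ^ 2) (Measure.pi fun _ : Fin n => P) := fun t =>
      (measurePreserving_eval (fun _ : Fin n => P) t).integrable_comp_of_integrable hP
    have hS : (scatter : (Fin n → EuclideanSpace ℝ (Fin d)) → ℝ) =
        fun y => ∑ t, ‖y t - θ‖ ^ 2 - n * ‖sampleMean y - θ‖ ^ 2 := by
      ext y
      rw [sum_sq_norm_sub hn y θ]
      ring
    have hsum := integrable_finsetSum Finset.univ fun t _ => hterm t
    have hSi : Integrable (scatter : (Fin n → EuclideanSpace ℝ (Fin d)) → ℝ)
        (Measure.pi fun _ : Fin n => P) := by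
      rw [hS]
      exact hsum.sub (hint.const_mul _)
    have hSint : ∫ y, scatter y ∂(Measure.pi fun _ : Fin n => P) = n * ∫ x, ‖x - θ‖ ^ 2 ∂P -
        n * ∫ y, ‖sampleMean y - θ‖ ^ 2 ∂(Measure.pi fun _ : Fin n => P) := by
      rw [hS, integral_sub hsum (hint.const_mul _), integral_const_mul,
        integral_finsetSum _ fun t _ => hterm t]
      have : ∀ t : Fin n, ∫ y, ‖y t - θ‖ ^ 2 ∂(Measure.pi fun _ : Fin n => P) =
          ∫ x, ‖x - θ‖ ^ 2 ∂P := fun t =>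
        integral_comp_eval (μ := fun _ : Fin n => P) (i := t)
          (f := fun x => ‖x - θ‖ ^ 2) hP.aestronglyMeasurable
      simp [this]
    have hi1 : Integrable (fun y => c + a / 2 * scatter y) (Measure.pi fun _ : Fin n => P) :=
      (integrable_const c).add (hSi.const_mul _)
    have hi2 := hint.const_mul b
    refine (expect_le_integral (hi1.sub hi2) h1).trans ?_
    rw [EReal.coe_le_coe_iff]
    simp only [Pi.sub_apply]
    rw [integral_sub hi1 hi2, integral_add (integrable_const c) (hSi.const_mul _),
      integral_const_mul, integral_const_mul, hSint]
    simp only [integral_const, probReal_univ, one_smul]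
    set I := ∫ y, ‖sampleMean y - θ‖ ^ 2 ∂(Measure.pi fun _ : Fin n => P) with hI
    have hI0 : 0 ≤ I := integral_nonneg fun y => by positivity
    -- The expected scatter is thus at most `n(n-1) I`, and `hab` makes the term `-bI` outweigh
    -- `a/2` times this.
    have h3 : a / 2 * (n * ∫ x, ‖x - θ‖ ^ 2 ∂P - n * I) ≤ a / 2 * (n * (n * I) - n * I) := by
      gcongr
    have h4 : a * n * (n - 1) * I ≤ 2 * b * I := mul_le_mul_of_nonneg_right hab hI0
    linarith
  -- Without a second moment, `h2` bounds `X` above by a constant minus a nonnegative function of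
  -- infinite mean, so the expectation is `-∞`.
  · have hpos : posExp (Measure.pi fun _ : Fin n => P) X ≠ ⊤ :=
      posExp_ne_top (K := C) fun y => (h2 y).trans (by
        rw [EReal.coe_le_coe_iff]
        have : 0 ≤ ‖sampleMean y - θ‖ ^ 2 / 4 := by positivity
        linarith)
    rw [expect_eq_bot hpos]
    · exact bot_le
    by_contra hneg
    refine hint ?_
    have hm : Continuous fun y : Fin n → EuclideanSpace ℝ (Fin d) =>
      C - ‖sampleMean y - θ‖ ^ 2 / 4 := by fun_prop
    have h5 : Integrable (fun y => C - ‖sampleMean y - θ‖ ^ 2 / 4)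
        (Measure.pi fun _ : Fin n => P) := by
      refine integrable_of_posExp_of_negExp hm.aestronglyMeasurable ?_
        (ne_top_of_le_ne_top hneg (negExp_anti h2))
      refine posExp_ne_top (K := C) fun y => ?_
      rw [EReal.coe_le_coe_iff]
      have : 0 ≤ ‖sampleMean y - θ‖ ^ 2 / 4 := by positivity
      linarith
    have h6 := ((integrable_const C).sub h5).const_mul 4
    refine h6.congr (ae_of_all _ fun y => ?_)
    simp only [Pi.sub_apply]
    ring

end

/-! ### Regret bounds for the mixture estimators. -/

section

variable {d n : ℕ}

theorem regretAt_le_of_le (θ : EuclideanSpace ℝ (Fin d))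
    {q : (Fin n → EuclideanSpace ℝ (Fin d)) → ℝ} {y : Fin n → EuclideanSpace ℝ (Fin d)} {p : ℝ}
    (hp : 0 < p) (hpq : p ≤ q y) :
    regretAt gaussDensity q θ y ≤
      ((Real.log (∏ t, gaussDensity θ (y t)) - Real.log p : ℝ) : EReal) := by
  rw [regretAt, logRatio_of_pos (Finset.prod_pos fun t _ => gaussDensity_pos θ _)
    (hp.trans_le hpq), EReal.coe_le_coe_iff]
  linarith [Real.log_le_log hp hpq]

theorem log_prod_gaussDensity (hn : 1 ≤ n) (θ : EuclideanSpace ℝ (Fin d))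
    (y : Fin n → EuclideanSpace ℝ (Fin d)) :
    Real.log (∏ t, gaussDensity θ (y t)) = -((n : ℝ) * d) / 2 * Real.log (2 * Real.pi) -
      scatter y / 2 - n / 2 * ‖sampleMean y - θ‖ ^ 2 := by
  rw [prod_gaussDensity hn, Real.log_mul (by positivity) (Real.exp_pos _).ne', Real.log_exp,
    Real.log_rpow (by positivity)]
  ring

theorem log_laplaceTail (hn : 1 ≤ n) {α : ℝ} (hα : 0 < α)
    (y : Fin n → EuclideanSpace ℝ (Fin d)) :
    Real.log (laplaceTail α n y) = -(((n : ℝ) - 1) * d) / 2 * Real.log (2 * Real.pi) -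
      scatter y / 2 - d * Real.log (2 / α) - d / 2 * Real.log n - α * ∑ j, |sampleMean y j| := by
  have hn0 : (0 : ℝ) < n := by exact_mod_cast hn
  have hs : Real.sqrt n ≠ 0 := (Real.sqrt_pos.2 hn0).ne'
  rw [laplaceTail, Real.log_mul (by positivity) (by positivity),
    Real.log_mul (by positivity) (by positivity), Real.log_mul (by positivity) (by positivity),
    Real.log_exp, Real.log_exp, Real.log_rpow (by positivity), Real.log_pow,
    Real.log_div hα.ne' (by positivity), Real.log_mul two_ne_zero hs, Real.log_sqrt hn0.le,
    Real.log_div two_ne_zero hα.ne', scatter]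
  ring

theorem sum_abs_le_mul_norm (x : EuclideanSpace ℝ (Fin d)) : ∑ j, |x j| ≤ d * ‖x‖ := by
  have h : ∀ j, |x j| ≤ ‖x‖ := fun j => PiLp.norm_apply_le x j
  calc ∑ j, |x j| ≤ ∑ _j : Fin d, ‖x‖ := Finset.sum_le_sum fun j _ => h j
    _ = d * ‖x‖ := by simp

/-- The Laplace tail has exactly the model's Gaussian factor in the scatter, so that factor cancels
and the bound depends on the data through the sample mean alone. -/
theorem regretAt_le_of_laplaceTail_le (hn : 1 ≤ n) {α lam M : ℝ} (hα : 0 < α) (hlam : 0 < lam)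
    {θ : EuclideanSpace ℝ (Fin d)} (hθ : ‖θ‖ ≤ M)
    {q : (Fin n → EuclideanSpace ℝ (Fin d)) → ℝ} {y : Fin n → EuclideanSpace ℝ (Fin d)}
    (hq : lam * laplaceTail α n y ≤ q y) :
    regretAt gaussDensity q θ y ≤ ((-Real.log lam + d / 2 * Real.log (n / (2 * Real.pi)) +
      d * Real.log (2 / α) + α * d * (M + ‖sampleMean y - θ‖) -
      n / 2 * ‖sampleMean y - θ‖ ^ 2 : ℝ) : EReal) := by
  have hn0 : (0 : ℝ) < n := by exact_mod_cast hn
  have hl := laplaceTail_pos hα hn y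
  refine (regretAt_le_of_le θ (mul_pos hlam hl) hq).trans (EReal.coe_le_coe_iff.2 ?_)
  rw [log_prod_gaussDensity hn, Real.log_mul hlam.ne' hl.ne', log_laplaceTail hn hα,
    Real.log_div hn0.ne' (by positivity)]
  have h1 : ∑ j, |sampleMean y j| ≤ d * (M + ‖sampleMean y - θ‖) := by
    refine (sum_abs_le_mul_norm _).trans (mul_le_mul_of_nonneg_left ?_ (Nat.cast_nonneg d))
    have := norm_add_le (sampleMean y - θ) θ
    rw [sub_add_cancel] at this
    linarith
  have h2 := mul_le_mul_of_nonneg_left h1 hα.le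
  linarith

/-- Completing the square in `αd r` costs half of the available `r²/2`. The remaining decay makes
the expected regret well defined under every law, and `-∞` when `r²` is not integrable. -/
theorem regretAt_le_const_sub (hn : 1 ≤ n) {α lam M : ℝ} (hα : 0 < α) (hlam : 0 < lam)
    {θ : EuclideanSpace ℝ (Fin d)} (hθ : ‖θ‖ ≤ M)
    {q : (Fin n → EuclideanSpace ℝ (Fin d)) → ℝ} {y : Fin n → EuclideanSpace ℝ (Fin d)}
    (hq : lam * laplaceTail α n y ≤ q y) :
    regretAt gaussDensity q θ y ≤ ((-Real.log lam + d / 2 * Real.log (n / (2 * Real.pi)) +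
      d * Real.log (2 / α) + α * d * M + (α * d) ^ 2 - ‖sampleMean y - θ‖ ^ 2 / 4 : ℝ) :
        EReal) := by
  have hn1 : (1 : ℝ) ≤ n := by exact_mod_cast hn
  refine (regretAt_le_of_laplaceTail_le hn hα hlam hθ hq).trans (EReal.coe_le_coe_iff.2 ?_)
  nlinarith [sq_nonneg (α * d - ‖sampleMean y - θ‖ / 2), sq_nonneg ‖sampleMean y - θ‖]

section Mixture

variable {Θ : Set (EuclideanSpace ℝ (Fin d))}

theorem regretAt_le_of_infDist_eq_zero (hn : 1 ≤ n) (hΘ : IsCompact Θ) (hne : Θ.Nonempty)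
    {v τ lam Z : ℝ} (hv : 0 < v) (hlam : lam < 1) (hZ : 0 < Z) {θ : EuclideanSpace ℝ (Fin d)}
    {q : (Fin n → EuclideanSpace ℝ (Fin d)) → ℝ} {y : Fin n → EuclideanSpace ℝ (Fin d)}
    (hq : (1 - lam) * (maxLikelihood Θ v τ y / Z) ≤ q y)
    (hy : sampleMean y ∈ Metric.cthickening τ Θ) :
    regretAt gaussDensity q θ y ≤ ((-Real.log (1 - lam) + n * d / 2 * Real.log v + Real.log Z +
      (1 / v - 1) / 2 * scatter y - n / 2 * ‖sampleMean y - θ‖ ^ 2 : ℝ) : EReal) := by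
  have hm := maxLikelihood_pos (τ := τ) hn hΘ hne hv y
  have hlam' : 0 < 1 - lam := by linarith
  refine (regretAt_le_of_le θ (mul_pos hlam' (div_pos hm hZ)) hq).trans
    (EReal.coe_le_coe_iff.2 (le_of_eq ?_))
  rw [log_prod_gaussDensity hn, Real.log_mul hlam'.ne' (div_pos hm hZ).ne',
    Real.log_div hm.ne' hZ.ne', maxLikelihood_eq hn hΘ hne hv, Metric.infDist_zero_of_mem hy,
    ← Real.exp_add, Real.log_mul (by positivity) (Real.exp_pos _).ne',
    Real.log_exp, Real.log_rpow (by positivity), Real.log_mul (by positivity) hv.ne']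
  ring

theorem log_volume_le_log_integral_maxLikelihood (hn : 1 ≤ n) (hΘ : IsCompact Θ)
    (hpos : 0 < volume Θ) {v τ : ℝ} (hv : 0 < v) :
    (d : ℝ) / 2 * Real.log (n / (2 * Real.pi)) - d / 2 * Real.log v +
      Real.log (volume Θ).toReal ≤
      Real.log (∫ y : Fin n → EuclideanSpace ℝ (Fin d), maxLikelihood Θ v τ y) := by
  have hn0 : (0 : ℝ) < n := by exact_mod_cast hn
  have hne : Θ.Nonempty := nonempty_of_measure_ne_zero hpos.ne'
  have hVpos : 0 < (volume Θ).toReal := ENNReal.toReal_pos hpos.ne' hΘ.measure_lt_top.ne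
  have h1 := volume_real_le_integral_exp_infDist (K := Metric.cthickening τ Θ) hΘ.cthickening
    (hne.mono (Metric.self_subset_cthickening Θ)) (b := n / (2 * v)) (by positivity)
    hΘ.measurableSet (Metric.self_subset_cthickening Θ)
  rw [integral_maxLikelihood hn hΘ hne hv, Real.log_mul (by positivity) (hVpos.trans_le h1).ne',
    Real.log_rpow (by positivity), ← div_div (n : ℝ) (2 * Real.pi) v,
    Real.log_div (by positivity) hv.ne']
  have h2 := Real.log_le_log hVpos h1
  linarith

/-- On the tube the Shtarkov component gives the bound without the `1/τ²` term. Off the tube the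
Laplace component loses an additive constant and a term linear in `r`. Since `r/τ ≥ 1` there, both
fit into that term. -/
theorem regretAt_le_scatter (hn : 2 ≤ n) (hΘ : IsCompact Θ) (hpos : 0 < volume Θ)
    {α v τ lam M : ℝ} (hα : 0 < α) (hv : 1 - 1 / (n : ℝ) ≤ v) (hv1 : v ≤ 1) (hτ : 0 < τ)
    (hτ1 : τ ≤ 1) (hlam : 0 < lam) (hlam1 : lam < 1) (hM : ∀ θ ∈ Θ, ‖θ‖ ≤ M)
    {g : (Fin n → EuclideanSpace ℝ (Fin d)) → ℝ} (hg : Integrable g)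
    (hmg : ∀ y, maxLikelihood Θ v τ y ≤ g y) {θ : EuclideanSpace ℝ (Fin d)} (hθ : θ ∈ Θ)
    (y : Fin n → EuclideanSpace ℝ (Fin d)) :
    regretAt gaussDensity (mixture lam (normalized g) (laplaceTail α n)) θ y ≤
      ((-Real.log (1 - lam) + n * d / 2 * Real.log v + Real.log (∫ z, g z) +
        (1 / v - 1) / 2 * scatter y - (n / 2 - (-Real.log lam +
          (|d * Real.log (2 / α) - Real.log (volume Θ).toReal + d / 2| + α * d * M + α * d)) /
          τ ^ 2) * ‖sampleMean y - θ‖ ^ 2 : ℝ) : EReal) := by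
  have hn1 : 1 ≤ n := by omega
  have hn2 : (2 : ℝ) ≤ n := by exact_mod_cast hn
  have h3 : 1 / (n : ℝ) ≤ 1 / 2 := one_div_le_one_div_of_le two_pos hn2
  have hv0 : 0 < v := by linarith
  have hne : Θ.Nonempty := nonempty_of_measure_ne_zero hpos.ne'
  have hM0 : 0 ≤ M := (norm_nonneg θ).trans (hM θ hθ)
  have hgpos : ∀ y, 0 < g y := fun y => (maxLikelihood_pos hn1 hΘ hne hv0 y).trans_le (hmg y)
  have hmi := integrable_maxLikelihood (n := n) (τ := τ) hn1 hΘ hne hv0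
  have hZ : 0 < ∫ z, g z := integral_pos_of_pos hg hgpos
  have hlog : -Real.log lam ≥ 0 := by linarith [Real.log_nonpos hlam.le hlam1.le]
  set r := ‖sampleMean y - θ‖ with hr
  set B := d * Real.log (2 / α) - Real.log (volume Θ).toReal + d / 2 with hB
  have hαd : 0 ≤ α * d := by positivity
  have hnum : 0 ≤ -Real.log lam + (|B| + α * d * M + α * d) := by positivity
  have ha : 0 ≤ 1 / v - 1 := by linarith [one_le_one_div hv0 hv1]
  by_cases hy : sampleMean y ∈ Metric.cthickening τ Θ
  · have hq : (1 - lam) * (maxLikelihood Θ v τ y / ∫ z, g z) ≤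
        mixture lam (normalized g) (laplaceTail α n) y := by
      refine le_trans ?_ (mul_normalized_le_mixture hn1 hα hlam y)
      have : 0 ≤ 1 - lam := by linarith
      gcongr
      exact hmg y
    refine (regretAt_le_of_infDist_eq_zero hn1 hΘ hne hv0 hlam1 hZ hq hy).trans
      (EReal.coe_le_coe_iff.2 ?_)
    have h4 : 0 ≤ (-Real.log lam + (|B| + α * d * M + α * d)) / τ ^ 2 * r ^ 2 := by positivity
    linarith
  · refine (regretAt_le_of_laplaceTail_le hn1 hα hlam (hM θ hθ)
      (mul_laplaceTail_le_mixture hg hgpos hlam1 y)).trans (EReal.coe_le_coe_iff.2 ?_)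
    have hrτ : τ ≤ r := by
      by_contra hlt
      refine hy (Metric.mem_cthickening_of_dist_le _ θ τ Θ hθ ?_)
      rw [dist_eq_norm]
      exact (not_le.1 hlt).le
    have h5 : Real.log (∫ y : Fin n → EuclideanSpace ℝ (Fin d), maxLikelihood Θ v τ y) ≤
        Real.log (∫ z, g z) :=
      Real.log_le_log (integral_pos_of_pos hmi (maxLikelihood_pos hn1 hΘ hne hv0))
        (integral_mono hmi hg hmg)
    have h6 := log_volume_le_log_integral_maxLikelihood (n := n) (τ := τ) hn1 hΘ hpos hv0
    -- The lower bound for `log Z` contains `-(d/2) log v`, so the off-tube comparison needs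
    -- `((n-1)d/2) log v ≥ -d/2`; this is the `d/2` in `B`.
    have h7 : -1 ≤ ((n : ℝ) - 1) * Real.log v := by
      have h8 : 0 < 1 - 1 / (n : ℝ) := by linarith
      have h9 := (Real.one_sub_inv_le_log_of_pos h8).trans (Real.log_le_log h8 hv)
      have h10 : 1 - (1 - 1 / (n : ℝ))⁻¹ = -1 / (n - 1) := by
        have : (n : ℝ) - 1 ≠ 0 := by linarith
        have : (n : ℝ) ≠ 0 := by linarith
        field_simp
        ring
      rw [h10, div_le_iff₀ (by linarith)] at h9
      linarith
    have h7' : -((d : ℝ) / 2) ≤ n * d / 2 * Real.log v - d / 2 * Real.log v := by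
      have := mul_le_mul_of_nonneg_left h7 (by positivity : (0 : ℝ) ≤ d / 2)
      linarith
    have h11 : 0 ≤ -Real.log (1 - lam) := by
      linarith [Real.log_nonpos (x := 1 - lam) (by linarith) (by linarith)]
    have h12 : 0 ≤ (1 / v - 1) / 2 * scatter y :=
      mul_nonneg (by linarith) (scatter_nonneg y)
    have hρ : 1 ≤ r / τ := (one_le_div hτ).2 hrτ
    have hr1 : r ≤ (r / τ) ^ 2 := by
      have : r ≤ r / τ := by
        rw [le_div_iff₀ hτ]
        nlinarith
      nlinarith
    have hone : 1 ≤ (r / τ) ^ 2 := one_le_pow₀ hρ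
    have h13 : (-Real.log lam + (|B| + α * d * M + α * d)) / τ ^ 2 * r ^ 2 =
        (-Real.log lam + |B| + α * d * M) * (r / τ) ^ 2 + α * d * (r / τ) ^ 2 := by
      rw [div_pow]
      ring
    have h14 : -Real.log lam + |B| + α * d * M ≤
        (-Real.log lam + |B| + α * d * M) * (r / τ) ^ 2 :=
      le_mul_of_one_le_right (by positivity) hone
    have h15 : α * d * r ≤ α * d * (r / τ) ^ 2 := mul_le_mul_of_nonneg_left hr1 hαd
    have h16 := le_abs_self B
    linarith

theorem admissible_mixture (hn : 1 ≤ n) {α lam M : ℝ} (hα : 0 < α) (hlam : 0 < lam)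
    (hM : ∀ θ ∈ Θ, ‖θ‖ ≤ M) {q : (Fin n → EuclideanSpace ℝ (Fin d)) → ℝ}
    (hq : ∀ y, lam * laplaceTail α n y ≤ q y) :
    Admissible gaussDensity Θ (iidLaws (EuclideanSpace ℝ (Fin d)) n) q ∧
      ∃ C : ℝ, worstRegret gaussDensity Θ (iidLaws (EuclideanSpace ℝ (Fin d)) n) q ≤ C := by
  set C := -Real.log lam + d / 2 * Real.log (n / (2 * Real.pi)) +
      d * Real.log (2 / α) + α * d * M + (α * d) ^ 2 with hC
  have hle : ∀ θ ∈ Θ, ∀ y, regretAt gaussDensity q θ y ≤ (C : EReal) := fun θ hθ y =>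
    (regretAt_le_const_sub hn hα hlam (hM θ hθ) (hq y)).trans (EReal.coe_le_coe_iff.2 (by
      have : 0 ≤ ‖sampleMean y - θ‖ ^ 2 / 4 := by positivity
      linarith))
  refine ⟨?_, C, ?_⟩
  · rintro _ ⟨P, hP, rfl⟩ θ hθ
    exact Or.inl (posExp_ne_top (hle θ hθ))
  · refine iSup₂_le fun Q hQ => iSup₂_le fun θ hθ => ?_
    obtain ⟨P, hP, rfl⟩ := hQ
    exact expect_le_const (hle θ hθ)

/-- `β` is twice the coefficient of `r²` lost off the tube, so the available quadratic term is `((n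
- β)/2) r²`. The tweaked variance is tuned so that the scatter term does not exceed it in
expectation. -/
theorem worstRegret_mixture_le (hn : 2 ≤ n) (hΘ : IsCompact Θ) (hpos : 0 < volume Θ)
    {α β τ lam M : ℝ} (hα : 0 < α) (hβ0 : 0 ≤ β) (hβn : β ≤ n) (hτ : 0 < τ)
    (hτ1 : τ ≤ 1) (hlam : 0 < lam) (hlam1 : lam < 1) (hM : ∀ θ ∈ Θ, ‖θ‖ ≤ M)
    (hβ : β = 2 * ((-Real.log lam + (|d * Real.log (2 / α) - Real.log (volume Θ).toReal + d / 2| +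
      α * d * M + α * d)) / τ ^ 2))
    {g : (Fin n → EuclideanSpace ℝ (Fin d)) → ℝ} (hg : Integrable g)
    (hmg : ∀ y, maxLikelihood Θ (tweakedVar β n) τ y ≤ g y) :
    worstRegret gaussDensity Θ (iidLaws (EuclideanSpace ℝ (Fin d)) n)
        (mixture lam (normalized g) (laplaceTail α n)) ≤
      ((-Real.log (1 - lam) + (-(d / 2) + β / n * (d / 2)) + Real.log (∫ z, g z) : ℝ) :
        EReal) := by
  have hn1 : 1 ≤ n := by omega
  have hn2 : (2 : ℝ) ≤ n := by exact_mod_cast hn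
  have hn0 : (0 : ℝ) < n := by linarith
  have hne : Θ.Nonempty := nonempty_of_measure_ne_zero hpos.ne'
  have hv : 1 - 1 / (n : ℝ) ≤ tweakedVar β n := by
    rw [tweakedVar]
    exact le_add_of_nonneg_right (by positivity)
  have hv1 : tweakedVar β n ≤ 1 := by
    have : β / (n : ℝ) ^ 2 ≤ 1 / n := by
      rw [div_le_div_iff₀ (by positivity) hn0]
      nlinarith
    rw [tweakedVar]
    linarith
  have h3 : 1 / (n : ℝ) ≤ 1 / 2 := one_div_le_one_div_of_le two_pos hn2
  have hv0 : 0 < tweakedVar β n := by linarith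
  have hveq : tweakedVar β n * (n : ℝ) ^ 2 = n * (n - 1) + β := by
    rw [tweakedVar]
    field_simp
  set v := tweakedVar β n with hvdef
  have hgpos : ∀ y, 0 < g y := fun y => (maxLikelihood_pos hn1 hΘ hne hv0 y).trans_le (hmg y)
  have ha : 0 ≤ 1 / v - 1 := by linarith [one_le_one_div hv0 hv1]
  -- From `v n² = n(n-1) + β` one gets `(1/v - 1)(n(n-1) + β) = n - β` exactly; the nonnegative part
  -- with `β` on the left is dropped.
  have hcoef : (1 / v - 1) * n * (n - 1) ≤ n - β := by
    have h4 : (1 / v - 1) * (n * (n - 1) + β) = n - β := by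
      rw [← hveq]
      have : (1 / v - 1) * (v * (n : ℝ) ^ 2) = n ^ 2 - v * n ^ 2 := by
        field_simp
      rw [this, hveq]
      ring
    nlinarith [mul_nonneg ha hβ0]
  refine iSup₂_le fun Q hQ => iSup₂_le fun θ hθ => ?_
  obtain ⟨P, hP, rfl⟩ := hQ
  refine (expect_le_of_le_scatter hn1 P θ ha (b := n / 2 - β / 2) (by linarith)
    (c := -Real.log (1 - lam) + n * d / 2 * Real.log v + Real.log (∫ z, g z)) (fun y => ?_)
    fun y => regretAt_le_const_sub hn1 hα hlam (hM θ hθ)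
      (mul_laplaceTail_le_mixture hg hgpos hlam1 y)).trans (EReal.coe_le_coe_iff.2 ?_)
  · have := regretAt_le_scatter hn hΘ hpos hα hv hv1 hτ hτ1 hlam hlam1 hM hg hmg hθ y
    rw [show (-Real.log lam + (|d * Real.log (2 / α) - Real.log (volume Θ).toReal + d / 2| +
      α * d * M + α * d)) / τ ^ 2 = β / 2 by rw [hβ]; ring] at this
    exact this
  -- Here the gain `-d/2` appears: `(nd/2) log v ≤ (nd/2)(v - 1)`.
  · have h5 := Real.log_le_sub_one_of_pos hv0
    have h6 : (n : ℝ) * d / 2 * (v - 1) = -(d / 2) + β / n * (d / 2) := by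
      rw [hvdef, tweakedVar]
      field_simp
      ring
    have h7 := mul_le_mul_of_nonneg_left h5 (by positivity : (0 : ℝ) ≤ n * d / 2)
    linarith

/-- Because `g` dominates the unit-variance maximum likelihood over a set containing `Θ`, it
dominates every likelihood, and the ratio to `(1 - λ) g / Z` is at most `Z / (1 - λ)`. -/
theorem worstSeqRegret_mixture_le (hn : 1 ≤ n) (hΘ : IsCompact Θ) (hpos : 0 < volume Θ)
    {α τ lam : ℝ} (hα : 0 < α) (hlam : 0 < lam) (hlam1 : lam < 1)
    {g : (Fin n → EuclideanSpace ℝ (Fin d)) → ℝ} (hg : Integrable g)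
    (hmg : ∀ y, maxLikelihood Θ 1 τ y ≤ g y) :
    worstSeqRegret gaussDensity Θ (mixture lam (normalized g) (laplaceTail α n)) ≤
      ((-Real.log (1 - lam) + Real.log (∫ z, g z) : ℝ) : EReal) := by
  have hne : Θ.Nonempty := nonempty_of_measure_ne_zero hpos.ne'
  have hn0 : (0 : ℝ) < n := by exact_mod_cast hn
  have hgpos : ∀ y, 0 < g y := fun y => (maxLikelihood_pos hn hΘ hne one_pos y).trans_le (hmg y)
  have hZ : 0 < ∫ z, g z := integral_pos_of_pos hg hgpos
  have hlam' : 0 < 1 - lam := by linarith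
  refine iSup_le fun y => iSup₂_le fun θ hθ => ?_
  have hf : 0 < ∏ t, gaussDensity θ (y t) := Finset.prod_pos fun t _ => gaussDensity_pos θ _
  have hfg : ∏ t, gaussDensity θ (y t) ≤ g y := by
    refine le_trans ?_ (hmg y)
    rw [maxLikelihood_eq hn hΘ hne one_pos, prod_gaussDensity hn, ← Real.exp_add, mul_one]
    refine mul_le_mul_of_nonneg_left (Real.exp_le_exp.2 ?_) (by positivity)
    have h1 := Metric.infDist_le_dist_of_mem (x := sampleMean y)
      (Metric.self_subset_cthickening (δ := τ) Θ hθ)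
    rw [dist_eq_norm] at h1
    have h2 := pow_le_pow_left₀ Metric.infDist_nonneg h1 2
    have h3 := mul_le_mul_of_nonneg_left h2 hn0.le
    linarith
  refine (regretAt_le_of_le θ (mul_pos hlam' (div_pos hf hZ)) (le_trans ?_
    (mul_normalized_le_mixture hn hα hlam y))).trans (EReal.coe_le_coe_iff.2 (le_of_eq ?_))
  · gcongr
  · rw [Real.log_mul hlam'.ne' (div_pos hf hZ).ne', Real.log_div hf.ne' hZ.ne']
    ring

end Mixture

end

/-! ### Choice of parameters and passage to the limit. -/

section

variable {d : ℕ}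

/-- An asymptotic upper bound together with finiteness yields a bound with a vanishing error. -/
theorem exists_tendsto_zero_of_eventually_le {x : ℕ → EReal} {L : ℕ → ℝ}
    (hfin : ∀ n, 1 ≤ n → ∃ K : ℝ, x n ≤ K)
    (hlim : ∀ δ : ℝ, 0 < δ → ∀ᶠ n in atTop, x n ≤ ((L n + δ : ℝ) : EReal)) :
    ∃ ε : ℕ → ℝ, (∀ n, 0 ≤ ε n) ∧ Tendsto ε atTop (𝓝 0) ∧
      ∀ n, 1 ≤ n → x n ≤ ((L n + ε n : ℝ) : EReal) := by
  have hreal : ∀ n, 1 ≤ n → ∃ r : ℝ, max (x n) (L n) = r := by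
    intro n hn
    obtain ⟨K, hK⟩ := hfin n hn
    have h1 : max (x n) (L n) ≠ ⊥ := (lt_max_of_lt_right (EReal.bot_lt_coe _)).ne'
    have h2 : max (x n) (L n) ≠ ⊤ :=
      (max_lt (hK.trans_lt (EReal.coe_lt_top _)) (EReal.coe_lt_top _)).ne
    exact ⟨_, (EReal.coe_toReal h2 h1).symm⟩
  -- The error is `max(x, L) - L`: the maximum with `L` makes it nonnegative and excludes the value
  -- `-∞`.
  have hch : ∀ n, ∃ e : ℝ, 0 ≤ e ∧ (1 ≤ n → max (x n) (L n) = ((L n + e : ℝ) : EReal)) := by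
    intro n
    by_cases hn : 1 ≤ n
    · obtain ⟨r, hr⟩ := hreal n hn
      have h3 : (L n : EReal) ≤ r := hr ▸ le_max_right _ _
      rw [EReal.coe_le_coe_iff] at h3
      exact ⟨r - L n, by linarith, fun _ => by rw [hr, add_sub_cancel]⟩
    · exact ⟨0, le_rfl, fun h => absurd h hn⟩
  choose ε hε0 hε using hch
  refine ⟨ε, hε0, ?_, fun n hn => (le_max_left _ _).trans_eq (hε n hn)⟩
  rw [Metric.tendsto_atTop']
  intro δ hδ
  obtain ⟨N, hN⟩ := eventually_atTop.1 (hlim (δ / 2) (half_pos hδ))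
  refine ⟨max N 1, fun n hn => ?_⟩
  have hn1 : 1 ≤ n := ((le_max_right N 1).trans_lt hn).le
  have h4 : ((L n + ε n : ℝ) : EReal) ≤ ((L n + δ / 2 : ℝ) : EReal) := by
    rw [← hε n hn1]
    exact max_le (hN n ((le_max_left N 1).trans hn.le))
      (EReal.coe_le_coe_iff.2 (by linarith))
  rw [EReal.coe_le_coe_iff] at h4
  rw [Real.dist_eq, sub_zero, abs_of_nonneg (hε0 n)]
  linarith

/-- Real parameters decaying slowly enough for the robustified estimators. -/
theorem exists_slow_parameters {C : ℝ} (hC : 0 ≤ C) :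
    ∃ τ lam β : ℕ → ℝ,
      (∀ n, 0 < τ n ∧ τ n ≤ 1 ∧ 0 < lam n ∧ lam n < 1 ∧ 0 < β n ∧
        β n = 2 * ((-Real.log (lam n) + C) / τ n ^ 2)) ∧
      Tendsto τ atTop (𝓝 0) ∧ Tendsto lam atTop (𝓝 0) ∧
      Tendsto (fun n : ℕ => β n / n) atTop (𝓝 0) := by
  -- With `τ = 1/s` and `λ = exp(-s)`, one has `β = 2(s + C)s² = O(s³) = O(n^(3/4))`, which is
  -- `o(n)`. Adding one to `n` keeps `s ≥ 1` at every index.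
  let s : ℕ → ℝ := fun n => ((n : ℝ) + 1) ^ (1 / 4 : ℝ)
  have hs1 : ∀ n, 1 ≤ s n := fun n =>
    Real.one_le_rpow (by linarith [(Nat.cast_nonneg n : (0 : ℝ) ≤ n)]) (by norm_num)
  have hs0 : ∀ n, 0 < s n := fun n => one_pos.trans_le (hs1 n)
  have hs4 : ∀ n, s n ^ 4 = n + 1 := by
    intro n
    simp only [s]
    rw [← Real.rpow_mul_natCast (by positivity)]
    norm_num
  have hs : Tendsto s atTop atTop :=
    (tendsto_rpow_atTop (by norm_num : (0 : ℝ) < 1 / 4)).comp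
      (tendsto_atTop_add_const_right _ 1 tendsto_natCast_atTop_atTop)
  have hinv : Tendsto (fun n => (s n)⁻¹) atTop (𝓝 0) := tendsto_inv_atTop_zero.comp hs
  refine ⟨fun n => (s n)⁻¹, fun n => Real.exp (-s n),
    fun n => 2 * ((-Real.log (Real.exp (-s n)) + C) / (s n)⁻¹ ^ 2), fun n => ?_, hinv,
    Real.tendsto_exp_neg_atTop_nhds_zero.comp hs, ?_⟩
  · refine ⟨inv_pos.2 (hs0 n), inv_le_one_of_one_le₀ (hs1 n), Real.exp_pos _, ?_, ?_, rfl⟩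
    · rw [Real.exp_lt_one_iff]
      exact neg_lt_zero.2 (hs0 n)
    · simp only [Real.log_exp, neg_neg]
      have := hs0 n
      positivity
  · have h1 : Tendsto (fun n => 4 * (1 + C) * (s n)⁻¹) atTop (𝓝 0) := by
      simpa using hinv.const_mul (4 * (1 + C))
    refine tendsto_of_tendsto_of_tendsto_of_le_of_le' tendsto_const_nhds h1
      (Eventually.of_forall fun n => ?_) ?_
    · simp only [Real.log_exp, neg_neg]
      have := hs0 n
      positivity
    · filter_upwards [eventually_ge_atTop 1] with n hn
      have hn1 : (1 : ℝ) ≤ n := by exact_mod_cast hn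
      have hpos := hs0 n
      simp only [Real.log_exp, neg_neg]
      rw [div_le_iff₀ (by linarith)]
      have h2 : (s n) ^ 4 ≤ 2 * n := by
        rw [hs4]
        linarith
      have h3 : s n + C ≤ (1 + C) * s n := by nlinarith [hs1 n]
      calc 2 * ((s n + C) / (s n)⁻¹ ^ 2) = 2 * ((s n + C) * s n ^ 2) := by
            rw [inv_pow, div_inv_eq_mul]
        _ ≤ 2 * ((1 + C) * s n * s n ^ 2) := by gcongr
        _ = 2 * (1 + C) * (s n)⁻¹ * s n ^ 4 := by field_simp
        _ ≤ 2 * (1 + C) * (s n)⁻¹ * (2 * n) := by gcongr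
        _ = 4 * (1 + C) * (s n)⁻¹ * n := by ring

variable {Θ : Set (EuclideanSpace ℝ (Fin d))}

/-- Strict positivity of `β` matters at `n = 1`, where the variance reduces to `β`. -/
theorem tweakedVar_pos {n : ℕ} (hn : 1 ≤ n) {β : ℝ} (hβ : 0 < β) : 0 < tweakedVar β n := by
  have hn1 : (1 : ℝ) ≤ n := by exact_mod_cast hn
  have h1 : 1 / (n : ℝ) ≤ 1 := by
    rw [div_le_one (by linarith)]
    exact hn1
  have h2 : 0 < β / (n : ℝ) ^ 2 := by positivity
  rw [tweakedVar]
  linarith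

/-- The sharp bounds hold only eventually, as they need `β ≤ n`. For the remaining `n` the regrets
are merely finite, and the error sequences absorb the difference. -/
theorem exists_optimal_estimators (hΘ : IsCompact Θ) (hpos : 0 < volume Θ) {α : ℝ} (hα : 0 < α) :
    ∃ τ lam β ε : ℕ → ℝ,
      (∀ n, 0 < τ n ∧ 0 < lam n ∧ lam n < 1 ∧ 0 < β n) ∧
      Tendsto τ atTop (𝓝 0) ∧ Tendsto lam atTop (𝓝 0) ∧
      Tendsto (fun n : ℕ => β n / n) atTop (𝓝 0) ∧
      (∀ n, 0 ≤ ε n) ∧ Tendsto ε atTop (𝓝 0) ∧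
      ∀ n : ℕ, 1 ≤ n →
        (∀ q : (Fin n → EuclideanSpace ℝ (Fin d)) → ℝ,
          q = mixture (lam n) (shtarkov Θ (tweakedVar (β n) n) (τ n) n) (laplaceTail α n) →
          IsDensity volume n q ∧
          Admissible gaussDensity Θ (iidLaws (EuclideanSpace ℝ (Fin d)) n) q ∧
          worstRegret gaussDensity Θ (iidLaws (EuclideanSpace ℝ (Fin d)) n) q ≤
            (((d : ℝ) / 2 * Real.log (n / (2 * Real.pi)) - d / 2 +
              Real.log (volume Θ).toReal + ε n : ℝ) : EReal)) ∧
        (∀ q : (Fin n → EuclideanSpace ℝ (Fin d)) → ℝ,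
          q = mixture (lam n) (shtarkovTwo Θ (tweakedVar (β n) n) (τ n) n) (laplaceTail α n) →
          IsDensity volume n q ∧
          Admissible gaussDensity Θ (iidLaws (EuclideanSpace ℝ (Fin d)) n) q ∧
          worstRegret gaussDensity Θ (iidLaws (EuclideanSpace ℝ (Fin d)) n) q ≤
            (((d : ℝ) / 2 * Real.log (n / (2 * Real.pi)) - d / 2 +
              Real.log (volume Θ).toReal + ε n : ℝ) : EReal) ∧
          worstSeqRegret gaussDensity Θ q ≤
            (((d : ℝ) / 2 * Real.log (n / (2 * Real.pi)) +
              Real.log (volume Θ).toReal + ε n : ℝ) : EReal)) := by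
  have hne : Θ.Nonempty := nonempty_of_measure_ne_zero hpos.ne'
  obtain ⟨M, hMΘ⟩ := hΘ.isBounded.subset_closedBall 0
  have hM : ∀ θ ∈ Θ, ‖θ‖ ≤ M := fun θ hθ => by simpa using hMΘ hθ
  have hM0 : 0 ≤ M := (norm_nonneg _).trans (hM _ hne.some_mem)
  set C := |d * Real.log (2 / α) - Real.log (volume Θ).toReal + d / 2| + α * d * M + α * d with hC
  have hC0 : 0 ≤ C := by positivity
  obtain ⟨τ, lam, β, hpar, hτ, hlam, hβ⟩ := exists_slow_parameters hC0
  let g₁ : ∀ n, (Fin n → EuclideanSpace ℝ (Fin d)) → ℝ := fun n y =>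
    maxLikelihood Θ (tweakedVar (β n) n) (τ n) y
  let g₂ : ∀ n, (Fin n → EuclideanSpace ℝ (Fin d)) → ℝ := fun n y =>
    max (maxLikelihood Θ (tweakedVar (β n) n) (τ n) y) (maxLikelihood Θ 1 (τ n) y)
  have hv : ∀ n, 1 ≤ n → 0 < tweakedVar (β n) n := fun n hn =>
    tweakedVar_pos hn (hpar n).2.2.2.2.1
  have hi₁ : ∀ n, 1 ≤ n → Integrable (g₁ n) := fun n hn =>
    integrable_maxLikelihood hn hΘ hne (hv n hn)
  have hi₂ : ∀ n, 1 ≤ n → Integrable (g₂ n) := fun n hn =>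
    integrable_max_maxLikelihood hn hΘ hne (hv n hn)
  have hm₁ : ∀ n, 1 ≤ n → Measurable (g₁ n) := fun n hn =>
    measurable_maxLikelihood hn hΘ hne (hv n hn)
  have hm₂ : ∀ n, 1 ≤ n → Measurable (g₂ n) := fun n hn =>
    (hm₁ n hn).max (measurable_maxLikelihood hn hΘ hne one_pos)
  have hp₁ : ∀ n, 1 ≤ n → ∀ y, 0 < g₁ n y := fun n hn y =>
    maxLikelihood_pos hn hΘ hne (hv n hn) y
  have hp₂ : ∀ n, 1 ≤ n → ∀ y, 0 < g₂ n y := fun n hn y => lt_max_of_lt_left (hp₁ n hn y)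
  have hadm : ∀ n, 1 ≤ n → ∀ g : (Fin n → EuclideanSpace ℝ (Fin d)) → ℝ, Integrable g →
      (∀ y, 0 < g y) → Admissible gaussDensity Θ (iidLaws (EuclideanSpace ℝ (Fin d)) n)
        (mixture (lam n) (normalized g) (laplaceTail α n)) ∧ ∃ K : ℝ,
        worstRegret gaussDensity Θ (iidLaws (EuclideanSpace ℝ (Fin d)) n)
          (mixture (lam n) (normalized g) (laplaceTail α n)) ≤ K := fun n hn g hg hgp =>
    admissible_mixture hn hα (hpar n).2.2.1 hM
      (mul_laplaceTail_le_mixture hg hgp (hpar n).2.2.2.1)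
  have hβle : ∀ᶠ n : ℕ in atTop, β n ≤ n := by
    filter_upwards [hβ.eventually_lt_const one_pos, eventually_ge_atTop 1] with n h1 h2
    have h3 : (0 : ℝ) < n := by exact_mod_cast h2
    rw [div_lt_one h3] at h1
    exact h1.le
  have hvev : ∀ᶠ n : ℕ in atTop, 1 - 1 / (n : ℝ) ≤ tweakedVar (β n) n ∧
      tweakedVar (β n) n ≤ 1 := by
    filter_upwards [hβle, eventually_ge_atTop 1] with n h1 h2
    have h3 : (0 : ℝ) < n := by exact_mod_cast h2
    have h4 : 0 < β n := (hpar n).2.2.2.2.1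
    have h5 : β n / (n : ℝ) ^ 2 ≤ 1 / n := by
      rw [div_le_div_iff₀ (by positivity) h3]
      nlinarith
    have h6 : 0 ≤ β n / (n : ℝ) ^ 2 := by positivity
    rw [tweakedVar]
    exact ⟨by linarith, by linarith⟩
  have hZ : ∀ δ : ℝ, 0 < δ → ∀ᶠ n in atTop, Real.log (∫ y, g₂ n y) ≤
      (d : ℝ) / 2 * Real.log (n / (2 * Real.pi)) + Real.log (volume Θ).toReal + δ := fun δ hδ =>
    eventually_integral_max_maxLikelihood_le hΘ hpos hvev (fun n => (hpar n).1.le) hτ hδ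
  have hloglam : Tendsto (fun n => -Real.log (1 - lam n)) atTop (𝓝 0) := by
    have h1 : Tendsto (fun n => 1 - lam n) atTop (𝓝 1) := by simpa using hlam.const_sub 1
    simpa using (h1.log one_ne_zero).neg
  have hβd : Tendsto (fun n => β n / n * ((d : ℝ) / 2)) atTop (𝓝 0) := by
    simpa using hβ.mul_const ((d : ℝ) / 2)
  have hZ12 : ∀ n, 1 ≤ n → Real.log (∫ y, g₁ n y) ≤ Real.log (∫ y, g₂ n y) := fun n hn =>
    Real.log_le_log (integral_pos_of_pos (hi₁ n hn) (hp₁ n hn))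
      (integral_mono (hi₁ n hn) (hi₂ n hn) fun y => le_max_left _ _)
  -- Stated for any `g` between `g₁` and `g₂`, so that one argument serves both estimators: the
  -- lower bound controls the regret, the upper bound the normalizer.
  have hworst : ∀ g : ∀ n, (Fin n → EuclideanSpace ℝ (Fin d)) → ℝ,
      (∀ n, 1 ≤ n → Integrable (g n)) → (∀ n y, g₁ n y ≤ g n y) → (∀ n y, g n y ≤ g₂ n y) →
      ∀ δ : ℝ, 0 < δ → ∀ᶠ n in atTop,
        worstRegret gaussDensity Θ (iidLaws (EuclideanSpace ℝ (Fin d)) n)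
          (mixture (lam n) (normalized (g n)) (laplaceTail α n)) ≤
        (((d : ℝ) / 2 * Real.log (n / (2 * Real.pi)) - d / 2 +
              Real.log (volume Θ).toReal + δ : ℝ) : EReal) := by
    intro g hgi hg1 hg2 δ hδ
    have hδ3 : 0 < δ / 3 := by positivity
    filter_upwards [hZ _ hδ3, hloglam.eventually_lt_const hδ3, hβd.eventually_lt_const hδ3,
      hβle, eventually_ge_atTop 2] with n h1 h2 h3 h4 hn
    have hn1 : 1 ≤ n := by omega
    obtain ⟨p1, p2, p3, p4, p5, p6⟩ := hpar n
    refine (worstRegret_mixture_le hn hΘ hpos hα p5.le h4 p1 p2 p3 p4 hM p6 (hgi n hn1)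
      (hg1 n)).trans (EReal.coe_le_coe_iff.2 ?_)
    have h5 : Real.log (∫ y, g n y) ≤ Real.log (∫ y, g₂ n y) :=
      Real.log_le_log (integral_pos_of_pos (hgi n hn1)
        fun y => (hp₁ n hn1 y).trans_le (hg1 n y)) (integral_mono (hgi n hn1) (hi₂ n hn1) (hg2 n))
    linarith
  obtain ⟨ε₁, hε₁0, hε₁, hb₁⟩ := exists_tendsto_zero_of_eventually_le
    (fun n hn => (hadm n hn (g₁ n) (hi₁ n hn) (hp₁ n hn)).2)
    (hworst g₁ hi₁ (fun _ _ => le_rfl) fun _ _ => le_max_left _ _)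
  obtain ⟨ε₂, hε₂0, hε₂, hb₂⟩ := exists_tendsto_zero_of_eventually_le
    (fun n hn => (hadm n hn (g₂ n) (hi₂ n hn) (hp₂ n hn)).2)
    (hworst g₂ hi₂ (fun _ _ => le_max_left _ _) fun _ _ => le_rfl)
  have hseq : ∀ n, 1 ≤ n → worstSeqRegret gaussDensity Θ
      (mixture (lam n) (normalized (g₂ n)) (laplaceTail α n)) ≤
      ((-Real.log (1 - lam n) + Real.log (∫ z, g₂ n z) : ℝ) : EReal) := fun n hn =>
    worstSeqRegret_mixture_le hn hΘ hpos hα (hpar n).2.2.1 (hpar n).2.2.2.1 (hi₂ n hn)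
      fun y => le_max_right _ _
  obtain ⟨ε₃, hε₃0, hε₃, hb₃⟩ := exists_tendsto_zero_of_eventually_le
    (L := fun n => (d : ℝ) / 2 * Real.log (n / (2 * Real.pi)) + Real.log (volume Θ).toReal)
    (fun n hn => ⟨_, hseq n hn⟩) (by
      intro δ hδ
      filter_upwards [hZ _ (half_pos hδ), hloglam.eventually_lt_const (half_pos hδ),
        eventually_ge_atTop 1] with n h1 h2 hn
      exact (hseq n hn).trans (EReal.coe_le_coe_iff.2 (by linarith)))
  refine ⟨τ, lam, β, fun n => ε₁ n + ε₂ n + ε₃ n, fun n => ?_, hτ, hlam, hβ, fun n => ?_, ?_,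
    fun n hn => ⟨?_, ?_⟩⟩
  · obtain ⟨p1, p2, p3, p4, p5, p6⟩ := hpar n
    exact ⟨p1, p3, p4, p5⟩
  · have := hε₁0 n
    have := hε₂0 n
    have := hε₃0 n
    positivity
  · simpa using (hε₁.add hε₂).add hε₃
  · rintro q rfl
    refine ⟨isDensity_mixture hn (hm₁ n hn) (hi₁ n hn) (hp₁ n hn) hα (hpar n).2.2.1
      (hpar n).2.2.2.1, (hadm n hn (g₁ n) (hi₁ n hn) (hp₁ n hn)).1,
      (hb₁ n hn).trans (EReal.coe_le_coe_iff.2 ?_)⟩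
    linarith [hε₂0 n, hε₃0 n]
  · rintro q rfl
    refine ⟨isDensity_mixture hn (hm₂ n hn) (hi₂ n hn) (hp₂ n hn) hα (hpar n).2.2.1
      (hpar n).2.2.2.1, (hadm n hn (g₂ n) (hi₂ n hn) (hp₂ n hn)).1,
      (hb₂ n hn).trans (EReal.coe_le_coe_iff.2 ?_), (hb₃ n hn).trans (EReal.coe_le_coe_iff.2 ?_)⟩
    · linarith [hε₁0 n, hε₃0 n]
    · linarith [hε₁0 n, hε₂0 n]

/-- Two extended-real sequences squeezed between a real sequence and its vanishing perturbation
differ by a vanishing real sequence. -/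
theorem exists_eq_add_of_squeeze {x c : ℕ → EReal} {L A ε : ℕ → ℝ} {a : ℝ}
    (hε : Tendsto ε atTop (𝓝 0)) (hA : ∀ n, A n = L n + a)
    (hc : ∀ n, 1 ≤ n → (L n : EReal) ≤ c n ∧ c n ≤ ((L n + ε n : ℝ) : EReal))
    (hx : ∀ n, 1 ≤ n → (A n : EReal) ≤ x n ∧ x n ≤ ((A n + ε n : ℝ) : EReal)) :
    ∃ e : ℕ → ℝ, Tendsto e atTop (𝓝 0) ∧
      ∀ n, 1 ≤ n → x n = c n + ((a + e n : ℝ) : EReal) := by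
  have hreal : ∀ {z : EReal} {u w : ℝ}, (u : EReal) ≤ z → z ≤ w →
      ((z.toReal : ℝ) : EReal) = z := fun h1 h2 =>
    EReal.coe_toReal (h2.trans_lt (EReal.coe_lt_top _)).ne
      ((EReal.bot_lt_coe _).trans_le h1).ne'
  refine ⟨fun n => (x n).toReal - (c n).toReal - a, ?_, fun n hn => ?_⟩
  -- Both `x - a` and `c` lie in `[L, L + ε]`, so they differ by at most `ε`.
  · refine squeeze_zero_norm' ?_ hε
    filter_upwards [eventually_ge_atTop 1] with n hn
    obtain ⟨h1, h2⟩ := hc n hn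
    obtain ⟨h3, h4⟩ := hx n hn
    have hcr := hreal h1 h2
    have hxr := hreal h3 h4
    rw [← hcr, EReal.coe_le_coe_iff] at h1 h2
    rw [← hxr, EReal.coe_le_coe_iff] at h3 h4
    rw [hA] at h3 h4
    rw [Real.norm_eq_abs, abs_le]
    exact ⟨by linarith, by linarith⟩
  · obtain ⟨h1, h2⟩ := hc n hn
    obtain ⟨h3, h4⟩ := hx n hn
    conv_lhs => rw [← hreal h3 h4]
    conv_rhs => rw [← hreal h1 h2]
    rw [← EReal.coe_add]
    congr 1
    ring

end

end Misspecified

/-! ### Assembly of the lower bounds with the estimators. -/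

theorem theorem1 (d : ℕ) (Θ : Set (EuclideanSpace ℝ (Fin d))) (hΘ : IsCompact Θ)
    (hpos : 0 < volume Θ) :
    -- the capacity is finite, and the distribution-free regret is asymptotically equal to it
    (∃ ε : ℕ → ℝ, Tendsto ε atTop (𝓝 0) ∧ ∀ n : ℕ, 1 ≤ n →
      Misspecified.capacity Misspecified.gaussDensity Θ volume n ≠ ⊤ ∧
      Misspecified.pacRegret Misspecified.gaussDensity Θ volume n =
        (Misspecified.capacity Misspecified.gaussDensity Θ volume n : EReal)
          + ((ε n : ℝ) : EReal)) ∧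
    -- the individual-sequence regret is larger by `d / 2`
    (∃ ε : ℕ → ℝ, Tendsto ε atTop (𝓝 0) ∧ ∀ n : ℕ, 1 ≤ n →
      Misspecified.seqRegret Misspecified.gaussDensity Θ volume n =
        (Misspecified.capacity Misspecified.gaussDensity Θ volume n : EReal)
          + (((d : ℝ) / 2 + ε n : ℝ) : EReal)) ∧
    -- explicit estimators
    (∀ α : ℝ, 0 < α → ∃ τ lam β ε : ℕ → ℝ,
      (∀ n, 0 < τ n ∧ 0 < lam n ∧ lam n < 1 ∧ 0 < β n) ∧
      Tendsto τ atTop (𝓝 0) ∧ Tendsto lam atTop (𝓝 0) ∧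
      Tendsto (fun n : ℕ => β n / n) atTop (𝓝 0) ∧ Tendsto ε atTop (𝓝 0) ∧
      ∀ n : ℕ, 1 ≤ n →
        -- the mixture with the one-variance Shtarkov density: distribution-free setting
        (∀ q : (Fin n → EuclideanSpace ℝ (Fin d)) → ℝ,
          q = Misspecified.mixture (lam n)
            (Misspecified.shtarkov Θ (Misspecified.tweakedVar (β n) n) (τ n) n)
            (Misspecified.laplaceTail α n) →
          Misspecified.IsDensity volume n q ∧
          Misspecified.Admissible Misspecified.gaussDensity Θ
            (Misspecified.iidLaws (EuclideanSpace ℝ (Fin d)) n) q ∧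
          Misspecified.worstRegret Misspecified.gaussDensity Θ
              (Misspecified.iidLaws (EuclideanSpace ℝ (Fin d)) n) q ≤
            (Misspecified.capacity Misspecified.gaussDensity Θ volume n : EReal)
              + ((ε n : ℝ) : EReal)) ∧
        -- the mixture with the two-variance Shtarkov density: both settings simultaneously
        (∀ q : (Fin n → EuclideanSpace ℝ (Fin d)) → ℝ,
          q = Misspecified.mixture (lam n)
            (Misspecified.shtarkovTwo Θ (Misspecified.tweakedVar (β n) n) (τ n) n)
            (Misspecified.laplaceTail α n) →
          Misspecified.IsDensity volume n q ∧
          Misspecified.Admissible Misspecified.gaussDensity Θ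
            (Misspecified.iidLaws (EuclideanSpace ℝ (Fin d)) n) q ∧
          Misspecified.worstRegret Misspecified.gaussDensity Θ
              (Misspecified.iidLaws (EuclideanSpace ℝ (Fin d)) n) q ≤
            (Misspecified.capacity Misspecified.gaussDensity Θ volume n : EReal)
              + ((ε n : ℝ) : EReal) ∧
          Misspecified.worstSeqRegret Misspecified.gaussDensity Θ q ≤
            Misspecified.seqRegret Misspecified.gaussDensity Θ volume n
              + ((ε n : ℝ) : EReal))) := by
  have hne : Θ.Nonempty := nonempty_of_measure_ne_zero hpos.ne'
  have hclow := fun n (hn : 1 ≤ n) => Misspecified.coe_le_capacity hn hΘ hpos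
  have hslow := fun n (hn : 1 ≤ n) => Misspecified.coe_le_seqRegret hn hΘ hpos
  have hcpac := fun n : ℕ => Misspecified.capacity_le_pacRegret (n := n) hne
  -- The minimax values do not involve `α`, so any positive value will do here; one is taken.
  obtain ⟨τ, lam, β, ε, -, -, -, -, -, hε, hest⟩ :=
    Misspecified.exists_optimal_estimators hΘ hpos one_pos
  have hpac : ∀ n, 1 ≤ n → Misspecified.pacRegret Misspecified.gaussDensity Θ volume n ≤
      (((d : ℝ) / 2 * Real.log (n / (2 * Real.pi)) - d / 2 +
        Real.log (volume Θ).toReal + ε n : ℝ) : EReal) := by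
    intro n hn
    obtain ⟨h1, h2, h3⟩ := (hest n hn).1 _ rfl
    exact iInf₂_le_of_le _ ⟨h1, h2⟩ h3
  have hseq : ∀ n, 1 ≤ n → Misspecified.seqRegret Misspecified.gaussDensity Θ volume n ≤
      (((d : ℝ) / 2 * Real.log (n / (2 * Real.pi)) +
        Real.log (volume Θ).toReal + ε n : ℝ) : EReal) := by
    intro n hn
    obtain ⟨h1, -, -, h4⟩ := (hest n hn).2 _ rfl
    exact iInf₂_le_of_le _ h1 h4
  -- The upper bound on the capacity, and hence its finiteness, is inherited from the
  -- distribution-free regret.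
  have hc : ∀ n, 1 ≤ n → _ := fun n hn =>
    And.intro (hclow n hn) ((hcpac n).trans (hpac n hn))
  refine ⟨?_, ?_, fun α hα => ?_⟩
  · obtain ⟨e, he, heq⟩ := Misspecified.exists_eq_add_of_squeeze (a := 0) hε
      (fun n => (add_zero _).symm) hc
      fun n hn => ⟨(hclow n hn).trans (hcpac n), hpac n hn⟩
    refine ⟨e, he, fun n hn => ⟨fun htop => ?_, ?_⟩⟩
    · have h := (hc n hn).2
      rw [htop, EReal.coe_ennreal_top] at h
      exact EReal.coe_ne_top _ (top_le_iff.1 h)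
    · rw [heq n hn, zero_add]
  · exact Misspecified.exists_eq_add_of_squeeze hε (fun n => by ring) hc
      fun n hn => ⟨hslow n hn, hseq n hn⟩
  · obtain ⟨τ, lam, β, ε, h1, h2, h3, h4, -, h5, h6⟩ :=
      Misspecified.exists_optimal_estimators hΘ hpos hα
    refine ⟨τ, lam, β, ε, h1, h2, h3, h4, h5, fun n hn => ⟨fun q hq => ?_, fun q hq => ?_⟩⟩
    · obtain ⟨k1, k2, k3⟩ := (h6 n hn).1 q hq
      refine ⟨k1, k2, k3.trans ?_⟩
      rw [EReal.coe_add]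
      exact add_le_add_left (hclow n hn) _
    · obtain ⟨k1, k2, k3, k4⟩ := (h6 n hn).2 q hq
      refine ⟨k1, k2, k3.trans ?_, k4.trans ?_⟩
      · rw [EReal.coe_add]
        exact add_le_add_left (hclow n hn) _
      · rw [EReal.coe_add]
        exact add_le_add_left (hslow n hn) _
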